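/- **Model.** Let $n,c\ge 1$. The ring with $c$ parallel links has node set $\mathbb Z/n$ and, for each node $a$, $c$ directed links from $a$ to $a+1$, labelled $1,\dots,c$; the links labelled $j$ form the $j$th single ring. In each time step $t=0,1,2,\dots$ an adversary injects a finite sequence of packets, specifying only their sources and destinations. A set of (directed, simple) paths for the packets is $(w,r)$-*admissible* if, for every $T\ge w$, every interval of $T$ steps and every link $e$, at most $Tr$ of the packets injected in the interval have a path through $e$; it is *weakly* $(W,R)$-*admissible* if for every $k\ge 0$ and every link $e$ at most $WR$ of the packets injected in the window $[kW,(k+1)W)$ have a path through $e$. Injections are $(w,r)$-admissible if $(w,r)$-admissible source–destination paths for them exist in the ring with $c$ parallel links. The network is empty at first. Each link transmits at most one packet per step; a schedule is *greedy* if a link transmits a packet whenever packets are waiting for it. **Algorithm.** Let $0<r<1$, $\varepsilon=1-r$, $0<\beta<1$, and $$W=\Big\lceil\frac{3}{r\varepsilon^2}\ln\frac{nc}{\beta}\Big\rceil,\qquad R=1-\varepsilon^2 .$$ An on-line source-routing algorithm assigns each packet, at its injection, to one of the $c$ single rings, as a function of the current time and of the packets injected before (with their rings) only; the packet follows this ring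 from its source to its destination. For a collection $P$ of packets, some of which have been assigned to a single ring, let $$h(P)=\sum_{e}\frac{\prod_{p\in P}E\big[(1+\varepsilon)^{X_e^{p}}\big]}{(1+\varepsilon)^{(1+\varepsilon)rW}},$$ where $X_e^p\in\{0,1\}$ indicates whether $p$ uses the link $e$, and the packets not yet assigned to a ring are assigned to one uniformly at random. Each window $[kW,(k+1)W)$ starts with $\lfloor crW\rfloor$ unassigned *ghost packets* from $a$ to $a+1$ for every node $a$. When a packet $p$ is injected, it replaces one ghost packet for each hop that it crosses. Let $P$ consist of the packets of the window routed so far (with their rings), $p$ (unassigned), and the remaining ghost packets. The algorithm *follows the estimator* if it always assigns $p$ to a ring for which $h$ does not increase, i.e. $h$ after the assignment of $p$ is at most $h(P)$. **Theorem.** (1) Let $n,c\ge1$, $w\in\mathbb N$ and $0<r<1$. There is $\beta\in(0,1)$ with $W\ge w$. For every $\beta\in(0,1)$ with $W\ge w$, there are deterministic on-line algorithms that follow the estimator, and there is a constant $B$ (depending on $n,c,w,r,\beta$ only) such that for every such algorithm and all $(w,r)$-admissible injections, * the routes that the algorithm produces are source–destination paths and are weakly $(W,R)$-admissible; * the network with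 these routes is stable under every greedy scheduler (e.g. FIFO): in every greedy schedule there are never more than $B$ packets in the network, and every packet reaches its destination within $B$ steps of its injection. (2) This fails if the adversary picks the routes: in the ring with $n=4$ nodes and $c=2$ parallel links there are $w$, $r\in(0,1)$, injections, and $(w,r)$-admissible paths for them, for which the number of packets in the network is unbounded in some FIFO schedule. -/

import Mathlib

noncomputable section

namespace RingRouting

/-! ### The ring with parallel links -/

/-- The link `(a, j)` is the link labelled `j` from node `a` to node `a + 1` (mod `n`). -/
abbrev Link (n c : ℕ) : Type := ZMod n × Fin c

/-- What the adversary specifies about a packet (besides its injection time). -/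
structure Packet (n : ℕ) where
  /-- the source node -/
  src : ZMod n
  /-- the destination node -/
  dst : ZMod n

/-- The nodes `a` such that a packet must cross from `a` to `a + 1` on its way around the ring,
in order of travel. -/
def Packet.hops {n : ℕ} (p : Packet n) : List (ZMod n) :=
  (List.range (p.dst - p.src).val).map fun k => p.src + (k : ZMod n)

/-- The route of the packet `p` along the `j`th single ring. -/
def ringRoute {n c : ℕ} (p : Packet n) (j : Fin c) : List (Link n c) :=
  p.hops.map fun a => (a, j)

/-- `IsWalk s π d`: the links of `π`, in this order, form a directed walk from `s` to `d`.
The label of the link may change from hop to hop. -/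
def IsWalk {n c : ℕ} : ZMod n → List (Link n c) → ZMod n → Prop
  | s, [], d => s = d
  | s, e :: π, d => e.1 = s ∧ IsWalk (e.1 + 1) π d

/-- `π` is a directed simple path (no repeated node) from the source to the destination of `p`. -/
def IsPathOf {n c : ℕ} (p : Packet n) (π : List (Link n c)) : Prop :=
  IsWalk p.src π p.dst ∧ (p.src :: π.map fun e => e.1 + 1).Nodup

/-! ### Injections, traffic and admissibility -/

/-- `inj t` lists the packets injected at step `t`, in order of injection. -/
abbrev Injections (n : ℕ) : Type := ℕ → List (Packet n)

/-- Routed injections: `π t` lists the paths of the packets injected at step `t`. -/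
abbrev Traffic (E : Type) : Type := ℕ → List (List E)

/-- `π` assigns to every packet of `inj` a path from its source to its destination. -/
def IsRouting {n c : ℕ} (inj : Injections n) (π : Traffic (Link n c)) : Prop :=
  ∀ t, List.Forall₂ IsPathOf (inj t) (π t)

/-- The number of paths through `e` of packets injected during the `T` steps from `t₀` on. -/
def load {E : Type} [DecidableEq E] (π : Traffic E) (t₀ T : ℕ) (e : E) : ℕ :=
  ∑ t ∈ Finset.Ico t₀ (t₀ + T), (π t).countP fun path => e ∈ path

/-- `(w, r)`-admissible paths. -/
def Admissible {E : Type} [DecidableEq E] (w : ℕ) (r : ℝ) (π : Traffic E) : Prop :=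
  ∀ T, w ≤ T → ∀ t₀ e, (load π t₀ T e : ℝ) ≤ T * r

/-- Weakly `(W, R)`-admissible paths: the bound holds for the windows `[kW, (k+1)W)`, which
partition time. -/
def WeaklyAdmissible {E : Type} [DecidableEq E] (W : ℕ) (R : ℝ) (π : Traffic E) : Prop :=
  ∀ k e, (load π (k * W) W e : ℝ) ≤ W * R

/-- The adversary, who specifies only sources and destinations, guarantees that
`(w, r)`-admissible paths exist in the ring with `c` parallel links. -/
def AdmissibleInjections {n : ℕ} (c w : ℕ) (r : ℝ) (inj : Injections n) : Prop :=
  ∃ π : Traffic (Link n c), IsRouting inj π ∧ Admissible w r π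

/-! ### Deterministic on-line source routing along single rings -/

/-- One entry per packet routed so far: injection time, packet, and the single ring chosen. -/
abbrev Log (n c : ℕ) : Type := List (ℕ × Packet n × Fin c)

/-- A deterministic on-line source-routing algorithm: from the current time, the log of all
packets injected earlier, and the new packet, it chooses a single ring for the new packet. -/
abbrev OnlineRouter (n c : ℕ) : Type := ℕ → Log n c → Packet n → Fin c

/-- Route, one after the other, the packets injected at step `t`. -/
def OnlineRouter.batch {n c : ℕ} (A : OnlineRouter n c) (t : ℕ) :
    Log n c → List (Packet n) → Log n c
  | _, [] => []
  | log, p :: ps => (t, p, A t log p) :: A.batch t (log ++ [(t, p, A t log p)]) ps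

/-- The log before step `t`. -/
def OnlineRouter.log {n c : ℕ} (A : OnlineRouter n c) (inj : Injections n) : ℕ → Log n c
  | 0 => []
  | t + 1 => A.log inj t ++ A.batch t (A.log inj t) (inj t)

/-- The routes that the algorithm `A` produces on the injections `inj`. -/
def OnlineRouter.traffic {n c : ℕ} (A : OnlineRouter n c) (inj : Injections n) :
    Traffic (Link n c) :=
  fun t => (A.batch t (A.log inj t) (inj t)).map fun x => ringRoute x.2.1 x.2.2

/-! ### Conditional probabilities with ghost packets

Throughout, `ε = 1 - r`. -/

/-- `W = ⌈3 / (r ε²) * ln (n c / β)⌉`. -/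
def windowLength (n c : ℕ) (r β : ℝ) : ℕ :=
  ⌈3 / (r * (1 - r) ^ 2) * Real.log (n * c / β)⌉₊

/-- `(1 + ε) ^ X` for the indicator `X` of the event that `p`, routed along the `j`th single ring,
uses the link `e`. -/
def weight {n c : ℕ} (ε : ℝ) (e : Link n c) (p : Packet n) (j : Fin c) : ℝ :=
  (1 + ε) ^ (if e ∈ ringRoute p j then 1 else 0)

/-- The expectation of `(1 + ε) ^ X`, given the single ring of the packet if this is fixed already
(`some j`), and for a uniformly random single ring otherwise (`none`). -/
def condWeight {n c : ℕ} (ε : ℝ) (e : Link n c) : Packet n × Option (Fin c) → ℝ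
  | (p, some j) => weight ε e p j
  | (p, none) => (∑ j : Fin c, weight ε e p j) / c

/-- The estimator `h` for a collection `P` of packets, some of which have been assigned to a
single ring. It bounds the conditional probability that some link is used by more than
`(1 + ε) r W` packets of `P`. -/
def estimator {n c : ℕ} [NeZero n] (r : ℝ) (W : ℕ) (P : Multiset (Packet n × Option (Fin c))) :
    ℝ :=
  ∑ e : Link n c,
    (P.map (condWeight (1 - r) e)).prod / (1 + (1 - r)) ^ ((1 + (1 - r)) * r * (W : ℝ))

/-- The ghost packets that remain after the packets `ps` have been injected: at first there are
`⌊c r W⌋` of them from each node `a` to `a + 1`, and every packet replaces one ghost packet for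
each hop that it crosses. -/
def ghosts {n : ℕ} [NeZero n] (c : ℕ) (r : ℝ) (W : ℕ) (ps : List (Packet n)) :
    Multiset (Packet n) :=
  ∑ a : ZMod n,
    Multiset.replicate (⌊(c : ℝ) * r * W⌋₊ - ps.countP fun p => a ∈ p.hops) ⟨a, a + 1⟩

/-- The entries of the log that belong to the same window of length `W` as the time `t`. -/
def currentWindow {n c : ℕ} (W t : ℕ) (log : Log n c) : Log n c :=
  log.filter fun x => x.1 / W = t / W

/-- The packets considered when `p` is routed at time `t`: the packets of the current window with
their single rings, the packet `p` itself (with the choice `δ`, or with `none` before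
the choice), and the remaining ghost packets, which have no single ring yet. -/
def pool {n c : ℕ} [NeZero n] (r : ℝ) (W t : ℕ) (log : Log n c) (p : Packet n)
    (δ : Option (Fin c)) : Multiset (Packet n × Option (Fin c)) :=
  (((currentWindow W t log).map fun x => (x.2.1, some x.2.2) : List _) : Multiset _) + {(p, δ)} +
    (ghosts c r W ((currentWindow W t log).map (fun x => x.2.1) ++ [p])).map fun g => (g, none)

/-- The algorithm `A` follows the method of conditional probabilities with ghost packets: it
always chooses a single ring that does not increase the estimator. -/
def FollowsEstimator {n c : ℕ} [NeZero n] (r : ℝ) (W : ℕ) (A : OnlineRouter n c) : Prop :=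
  ∀ t log p, estimator r W (pool r W t log p (some (A t log p))) ≤
    estimator r W (pool r W t log p none)

/-! ### Greedy scheduling and stability

In each step, the newly injected packets join the queues of their first links, and then every link
may forward one of the packets waiting for it; this packet is available at its next link
(or has left the network) in the next step. The network is empty at first. -/

/-- `(t, k)` stands for the packet with index `k` among those injected at step `t`. -/
abbrev PacketId : Type := ℕ × ℕ

/-- The route of a packet; empty if there is no packet `i`. -/
def routeOf {E : Type} (π : Traffic E) (i : PacketId) : List E :=
  ((π i.1)[i.2]?).getD []

/-- `S s e` is the packet that crosses the link `e` in step `s`, if any. -/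
abbrev Schedule (E : Type) : Type := ℕ → E → Option PacketId

open Classical in
/-- The number of links of its route that the packet `i` has crossed before step `s`. -/
def progress {E : Type} (π : Traffic E) (S : Schedule E) (i : PacketId) : ℕ → ℕ
  | 0 => 0
  | s + 1 =>
    if ∃ e, i.1 ≤ s ∧ (routeOf π i)[progress π S i s]? = some e ∧ S s e = some i then
      progress π S i s + 1
    else progress π S i s

/-- In step `s` the packet `i` waits for the link `e`. -/
def Waiting {E : Type} (π : Traffic E) (S : Schedule E) (s : ℕ) (e : E) (i : PacketId) : Prop :=
  i.1 ≤ s ∧ (routeOf π i)[progress π S i s]? = some e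

/-- A greedy schedule: a link forwards only packets that wait for it, one at a time, and it
forwards one whenever packets are waiting. Which one is arbitrary. -/
def IsGreedy {E : Type} (π : Traffic E) (S : Schedule E) : Prop :=
  ∀ s e, (∀ i, S s e = some i → Waiting π S s e i) ∧
    ((∃ i, Waiting π S s e i) → ∃ i, S s e = some i)

/-- The step in which the packet `i` arrived at the link for which it waits in step `s`. -/
def arrivalTime {E : Type} (π : Traffic E) (S : Schedule E) (s : ℕ) (i : PacketId) : ℕ :=
  sInf {s' | i.1 ≤ s' ∧ progress π S i s' = progress π S i s}

/-- A First-In-First-Out schedule: greedy, with priority to the packets that arrived earliest at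
the link. -/
def IsFIFO {E : Type} (π : Traffic E) (S : Schedule E) : Prop :=
  IsGreedy π S ∧ ∀ s e i, S s e = some i → ∀ i', Waiting π S s e i' →
    arrivalTime π S s i ≤ arrivalTime π S s i'

/-- The packets in the network in step `s`. -/
def inNetwork {E : Type} (π : Traffic E) (S : Schedule E) (s : ℕ) : Set PacketId :=
  {i | ∃ e, Waiting π S s e i}

/-- There are never more than `B` packets in the network, and every packet has reached its
destination `B` steps after its injection. -/
def BoundedBy {E : Type} (π : Traffic E) (S : Schedule E) (B : ℕ) : Prop :=
  (∀ s, (inNetwork π S s).encard ≤ B) ∧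
    ∀ i : PacketId, (routeOf π i).length ≤ progress π S i (i.1 + B)

end RingRouting

end

open RingRouting

noncomputable section

namespace RingRouting

/-! ### Progress of packets -/

section Progress

variable {E : Type} {π : Traffic E} {S : Schedule E}

/-! Routing. Within a window, h is a union bound over the links of conditional Chernoff bounds. With
ghosts only, each of its n c terms is at most exp(εrW - (1+ε)rW ln(1+ε)) ≤ exp(-rWε²/3) ≤ β/(nc), so
h ≤ β (`potential_nil_le`). An unassigned packet has the same expected weight at each link as the
ghosts that it replaces, so the replacement preserves h while ghosts last (`estimator_pool_none`).
They do last: every simple path of a packet crosses the same hops, so admissibility bounds the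
crossings of each hop by crW. Averaging over the rings yields a choice that does not increase h.
Thus h ≤ β < 1 at the end of the window, and every link carries at most (1+ε)rW = (1-ε²)W packets.

Stability. Let N(e,t) count the packets present at t that still have to cross e. While e is busy,
N(e,·) drifts down at rate δ, up to an additive constant. When e is idle, every packet that needs e
also needs the preceding link of its ring (`FollowsRings.needing_pred`). Going back to the last idle
step of e, then of its predecessor, and so on once around the ring (`FollowsRings.chain`), bounds
N(e,t) by N(e,u) + n(b+1) - δ(t-u). If t-u is large, induction applies. Otherwise all packets
counted at t were injected after u, because an older one would have needed the whole ring at u.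

Instability. A period turns s one-hop packets at a link into more than s at the link two hops ahead.
While the s packets leave, three-hop packets collect behind them; while those leave, packets that
will switch rings collect behind them and one-hop packets delay the others at the second link;
finally both streams meet at the third link, which also receives fresh packets
(`Config.run_period`). An explicit system of queues realizes this as a FIFO schedule
(`IsPredecessorList.isFIFO`). -/

theorem progress_succ_of_crossing {i : PacketId} {s : ℕ} {e : E} (hw : Waiting π S s e i)
    (hS : S s e = some i) : progress π S i (s + 1) = progress π S i s + 1 := by
  rw [progress, if_pos ⟨e, hw.1, hw.2, hS⟩]

theorem progress_succ_of_not_crossing {i : PacketId} {s : ℕ}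
    (h : ∀ e, Waiting π S s e i → S s e ≠ some i) :
    progress π S i (s + 1) = progress π S i s := by
  rw [progress, if_neg]
  rintro ⟨e, h1, h2, h3⟩
  exact h e ⟨h1, h2⟩ h3

theorem progress_monotone (i : PacketId) : Monotone (progress π S i) := by
  refine monotone_nat_of_le_succ fun s => ?_
  rw [progress]
  split_ifs <;> omega

theorem progress_eq_zero {i : PacketId} {s : ℕ} (h : s ≤ i.1) : progress π S i s = 0 := by
  induction s with
  | zero => rfl
  | succ s ih =>
    rw [progress_succ_of_not_crossing, ih (by omega)]
    intro e hw
    have := hw.1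
    omega

theorem Waiting.eq_link {i : PacketId} {s : ℕ} {e f : E} (he : Waiting π S s e i)
    (hf : Waiting π S s f i) : e = f :=
  Option.some_injective _ (he.2.symm.trans hf.2)

theorem busy_or_last_idle (e : E) (t : ℕ) :
    (∀ s ≤ t, ∃ i, Waiting π S s e i) ∨
      ∃ u ≤ t, (¬ ∃ i, Waiting π S u e i) ∧ ∀ s, u < s → s ≤ t → ∃ i, Waiting π S s e i := by
  induction t with
  | zero =>
    by_cases h : ∃ i, Waiting π S 0 e i
    · exact Or.inl fun s hs => by rwa [Nat.le_zero.1 hs]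
    · exact Or.inr ⟨0, le_rfl, h, fun s h1 h2 => by omega⟩
  | succ t ih =>
    by_cases h : ∃ i, Waiting π S (t + 1) e i
    · rcases ih with h' | ⟨u, hu, hi, hb⟩
      · refine Or.inl fun s hs => ?_
        rcases Nat.le_succ_iff.1 hs with h1 | rfl
        exacts [h' s h1, h]
      · refine Or.inr ⟨u, by omega, hi, fun s h1 h2 => ?_⟩
        rcases Nat.le_succ_iff.1 h2 with h3 | rfl
        exacts [hb s h1 h3, h]
    · exact Or.inr ⟨t + 1, le_rfl, h, fun s h1 h2 => by omega⟩

theorem waiting_injection {t : ℕ} {f : E} {i : PacketId} (hi : i.1 = t) :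
    Waiting π S t f i ↔ (routeOf π i).head? = some f := by
  rw [Waiting, progress_eq_zero hi.ge, List.head?_eq_getElem?]
  exact and_iff_right hi.le

theorem arrivalTime_le {s : ℕ} {i : PacketId} (h : i.1 ≤ s) : arrivalTime π S s i ≤ s :=
  Nat.sInf_le ⟨h, rfl⟩

theorem arrivalTime_injection {s : ℕ} {i : PacketId} (h : i.1 = s) : arrivalTime π S s i = s := by
  refine le_antisymm (arrivalTime_le h.le) (le_csInf ⟨s, h.le, rfl⟩ ?_)
  rintro s' ⟨h1, -⟩
  omega

theorem arrivalTime_succ_of_crossing {s : ℕ} {i : PacketId} (h : i.1 ≤ s)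
    (hp : progress π S i (s + 1) = progress π S i s + 1) :
    arrivalTime π S (s + 1) i = s + 1 := by
  refine le_antisymm (arrivalTime_le (by omega)) (le_csInf ⟨s + 1, by omega, rfl⟩ ?_)
  rintro s' ⟨-, h2⟩
  by_contra hlt
  have := progress_monotone (π := π) (S := S) i (show s' ≤ s by omega)
  omega

theorem arrivalTime_succ_of_waiting {s : ℕ} {i : PacketId}
    (hp : progress π S i (s + 1) = progress π S i s) :
    arrivalTime π S (s + 1) i = arrivalTime π S s i := by
  rw [arrivalTime, arrivalTime, hp]

end Progress

/-! ### Load -/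

/-- Loads count list entries with multiplicity, packets are identified by their indices; this links
the two. -/
theorem countP_eq_card_filter_range {α : Type*} [DecidableEq α] (p : α → Bool) (d : α) (l : List α) :
    l.countP p = {k ∈ Finset.range l.length | p ((l[k]?).getD d)}.card := by
  induction l using List.reverseRecOn with
  | nil => simp
  | append_singleton l x ih =>
    rw [List.length_append, List.length_singleton, Finset.range_add_one, Finset.filter_insert,
      List.countP_append, ih]
    have h : {k ∈ Finset.range l.length | p (((l ++ [x])[k]?).getD d)} =
        {k ∈ Finset.range l.length | p ((l[k]?).getD d)} := by
      refine Finset.filter_congr fun k hk => ?_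
      rw [List.getElem?_append_left (Finset.mem_range.1 hk)]
    rw [h]
    by_cases hx : p x <;> simp [hx]

section Load

variable {E : Type} [DecidableEq E] (π : Traffic E)

theorem load_add (a k l : ℕ) (e : E) :
    load π a (k + l) e = load π a k e + load π (a + k) l e := by
  simp only [load]
  rw [← add_assoc, Finset.sum_Ico_consecutive _ (by omega) (by omega)]

/-- The packets injected during `[a, b)` whose routes use `e`. -/
def users (a b : ℕ) (e : E) : Finset PacketId :=
  (Finset.Ico a b).biUnion fun t =>
    {k ∈ Finset.range (π t).length | e ∈ routeOf π (t, k)}.image (Prod.mk t)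

variable {π}

theorem mem_users {a b : ℕ} {e : E} {i : PacketId} :
    i ∈ users π a b e ↔ (a ≤ i.1 ∧ i.1 < b) ∧ e ∈ routeOf π i := by
  obtain ⟨t, k⟩ := i
  simp only [users, Finset.mem_biUnion, Finset.mem_Ico, Finset.mem_image, Finset.mem_filter,
    Finset.mem_range, Prod.mk.injEq]
  constructor
  · rintro ⟨t', ht, k', ⟨-, h⟩, rfl, rfl⟩
    exact ⟨ht, h⟩
  · rintro ⟨ht, h⟩
    refine ⟨t, ht, k, ⟨?_, h⟩, rfl, rfl⟩
    by_contra hk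
    simp [routeOf, List.getElem?_eq_none (not_lt.1 hk)] at h

theorem card_users_le (a k : ℕ) (e : E) : (users π a (a + k) e).card ≤ load π a k e := by
  refine Finset.card_biUnion_le.trans (Finset.sum_le_sum fun t _ => ?_)
  refine Finset.card_image_le.trans (le_of_eq ?_)
  rw [countP_eq_card_filter_range (fun path => decide (e ∈ path)) []]
  congr 1
  refine Finset.filter_congr fun k _ => ?_
  simp [routeOf]

/-- Weak admissibility bounds the load of arbitrary intervals. -/
theorem WeaklyAdmissible.load_le {W : ℕ} {R : ℝ} (h : WeaklyAdmissible W R π) (hW : 0 < W)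
    (hR : 0 ≤ R) (hR1 : R ≤ 1) (a T : ℕ) (e : E) : (load π a T e : ℝ) ≤ T * R + 2 * W := by
  have hm : ∀ k m : ℕ, (load π (k * W) (m * W) e : ℝ) ≤ m * (W * R) := by
    intro k m
    induction m with
    | zero => simp [load]
    | succ m ih =>
      rw [add_mul, one_mul, load_add, ← add_mul]
      push_cast
      linarith [h (k + m) e]
  -- The number of aligned windows from the one containing a to the one containing a + T; together
  -- they are at most T + 2W long.
  set m := (a + T) / W - a / W + 1
  have h1 : a / W * W ≤ a := Nat.div_mul_le_self a W
  have h2 : a < a / W * W + W := Nat.lt_div_mul_add hW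
  have h3 : (a + T) / W * W ≤ a + T := Nat.div_mul_le_self _ W
  have h4 : a + T < (a + T) / W * W + W := Nat.lt_div_mul_add hW
  have h5 : a / W ≤ (a + T) / W := Nat.div_le_div_right (by omega)
  have h6 : m * W + a / W * W = (a + T) / W * W + W := by
    rw [← add_mul, ← Nat.succ_mul]
    congr 1
    omega
  have h7 : load π a T e ≤ load π (a / W * W) (m * W) e := by
    refine Finset.sum_le_sum_of_subset (Finset.Ico_subset_Ico h1 ?_)
    omega
  have h8 : ((m * W : ℕ) : ℝ) ≤ T + 2 * W := by exact_mod_cast (by omega : m * W ≤ T + 2 * W)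
  push_cast at h8
  calc (load π a T e : ℝ) ≤ load π (a / W * W) (m * W) e := by exact_mod_cast h7
    _ ≤ m * (W * R) := hm _ _
    _ = (m * W) * R := by ring
    _ ≤ (T + 2 * W) * R := by gcongr
    _ ≤ T * R + 2 * W := by nlinarith [(Nat.cast_nonneg W : (0 : ℝ) ≤ W)]

end Load

/-! ### Packets that still need a link -/

section Needing

variable {E : Type} [DecidableEq E] (π : Traffic E) (S : Schedule E)

/-- The packets in the network in step `s` that have not crossed `e` but will do so. -/
def needing (e : E) (s : ℕ) : Finset PacketId :=
  {i ∈ users π 0 (s + 1) e | e ∈ (routeOf π i).drop (progress π S i s)}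

variable {π S}

theorem mem_needing {e : E} {s : ℕ} {i : PacketId} :
    i ∈ needing π S e s ↔ i.1 ≤ s ∧ e ∈ (routeOf π i).drop (progress π S i s) := by
  simp only [needing, Finset.mem_filter, mem_users]
  constructor
  · rintro ⟨h, h'⟩
    exact ⟨by omega, h'⟩
  · rintro ⟨h, h'⟩
    exact ⟨⟨⟨by omega, by omega⟩, List.mem_of_mem_drop h'⟩, h'⟩

theorem Waiting.mem_needing {e : E} {s : ℕ} {i : PacketId} (h : Waiting π S s e i) :
    i ∈ needing π S e s := by
  refine RingRouting.mem_needing.2 ⟨h.1, List.mem_iff_getElem?.2 ⟨0, ?_⟩⟩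
  rw [List.getElem?_drop, add_zero, h.2]

theorem mem_needing_of_le {e : E} {s t : ℕ} {i : PacketId} (h : i ∈ needing π S e t)
    (his : i.1 ≤ s) (hst : s ≤ t) : i ∈ needing π S e s := by
  rw [mem_needing] at h ⊢
  exact ⟨his, (List.drop_subset_drop_left _ (progress_monotone i hst)) h.2⟩

theorem needing_succ_subset (e : E) (s : ℕ) :
    needing π S e (s + 1) ⊆ needing π S e s ∪ users π (s + 1) (s + 1 + 1) e := by
  intro i hi
  rw [Finset.mem_union]
  by_cases h : i.1 ≤ s
  · exact Or.inl (mem_needing_of_le hi h (by omega))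
  · rw [mem_needing] at hi
    exact Or.inr (mem_users.2 ⟨⟨by omega, by omega⟩, List.mem_of_mem_drop hi.2⟩)

theorem card_needing_succ_le (e : E) (s : ℕ) :
    (needing π S e (s + 1)).card ≤ (needing π S e s).card + load π (s + 1) 1 e :=
  (Finset.card_le_card (needing_succ_subset e s)).trans
    ((Finset.card_union_le _ _).trans (by gcongr; exact card_users_le _ _ _))

/-- The packet that a busy link serves never needs this link again, because its route has no
repeated link. -/
theorem card_needing_succ_of_busy (hS : IsGreedy π S) (hnd : ∀ i, (routeOf π i).Nodup) {e : E}
    {s : ℕ} (hb : ∃ i, Waiting π S s e i) :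
    (needing π S e (s + 1)).card + 1 ≤ (needing π S e s).card + load π (s + 1) 1 e := by
  obtain ⟨i, hi⟩ := (hS s e).2 hb
  have hw := (hS s e).1 i hi
  have hsub : needing π S e (s + 1) ⊆
      (needing π S e s).erase i ∪ users π (s + 1) (s + 1 + 1) e := by
    intro k hk
    rcases Finset.mem_union.1 (needing_succ_subset e s hk) with h | h
    · refine Finset.mem_union_left _ (Finset.mem_erase.2 ⟨?_, h⟩)
      rintro rfl
      rw [mem_needing, progress_succ_of_crossing hw hi] at hk
      have hd := (hnd k).sublist (List.drop_sublist (progress π S k s) _)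
      obtain ⟨hlt, he⟩ := List.getElem?_eq_some_iff.1 hw.2
      rw [List.drop_eq_getElem_cons hlt, he, List.nodup_cons] at hd
      exact hd.1 hk.2
    · exact Finset.mem_union_right _ h
  have h1 := Finset.card_erase_add_one hw.mem_needing
  have h2 := (Finset.card_le_card hsub).trans (Finset.card_union_le _ _)
  have h3 := card_users_le (π := π) (s + 1) 1 e
  omega

theorem card_needing_add_of_busy (hS : IsGreedy π S) (hnd : ∀ i, (routeOf π i).Nodup) {e : E}
    {u k : ℕ} (hb : ∀ s, u ≤ s → s < u + k → ∃ i, Waiting π S s e i) :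
    (needing π S e (u + k)).card + k ≤ (needing π S e u).card + load π (u + 1) k e := by
  induction k with
  | zero => simp
  | succ k ih =>
    have h1 := ih fun s h h' => hb s h (by omega)
    have h2 := card_needing_succ_of_busy hS hnd (hb (u + k) (by omega) (by omega))
    rw [load_add]
    have h3 : u + 1 + k = u + k + 1 := by omega
    rw [h3]
    change (needing π S e (u + k + 1)).card + _ ≤ _
    omega

/-- After the last idle step u, all steps before t serve a packet, so the count changes by arrivals
minus services. The 1 in b + 1 pays for step u itself, in which nothing is served. The first
alternative covers a link that has always been busy. -/
theorem card_needing_le_last_idle (hS : IsGreedy π S) (hnd : ∀ i, (routeOf π i).Nodup) {δ b : ℝ}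
    (hδ : 0 < δ) (hb0 : 0 ≤ b) (hb : ∀ a T e, (load π a T e : ℝ) ≤ T * (1 - δ) + b) (e : E)
    (t : ℕ) :
    ((needing π S e t).card : ℝ) ≤ b + 1 ∨
      ∃ u ≤ t, (¬ ∃ i, Waiting π S u e i) ∧
        ((needing π S e t).card : ℝ) ≤ (needing π S e u).card + (b + 1) - δ * (t - u) := by
  rcases busy_or_last_idle (π := π) (S := S) e t with h | ⟨u, hu, hi, hbusy⟩
  · left
    have h1 := card_needing_add_of_busy (u := 0) (k := t) hS hnd fun s _ hs => h s (by omega)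
    have h2 : (needing π S e 0).card ≤ load π 0 1 e :=
      (Finset.card_le_card (Finset.filter_subset _ _)).trans (card_users_le 0 1 e)
    have h3 := load_add π 0 1 t e
    have h4 := hb 0 (1 + t) e
    simp only [zero_add] at h1 h3
    have h5 : ((needing π S e t).card : ℝ) + t ≤ load π 0 (1 + t) e := by
      exact_mod_cast (by omega : (needing π S e t).card + t ≤ load π 0 (1 + t) e)
    push_cast at h4
    nlinarith [(Nat.cast_nonneg t : (0 : ℝ) ≤ t)]
  · refine Or.inr ⟨u, hu, hi, ?_⟩
    rcases hu.eq_or_lt with rfl | hlt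
    · simp only [sub_self, mul_zero]
      linarith
    obtain ⟨k, rfl⟩ : ∃ k, t = u + 1 + k := ⟨t - (u + 1), by omega⟩
    have h1 := card_needing_add_of_busy (u := u + 1) (k := k) hS hnd
      fun s h1 h2 => hbusy s (by omega) (by omega)
    have h2 := card_needing_succ_le (π := π) (S := S) e u
    have h3 := load_add π (u + 1) 1 k e
    have h4 := hb (u + 1) (1 + k) e
    have h5 : ((needing π S e (u + 1 + k)).card : ℝ) + k ≤
        (needing π S e u).card + load π (u + 1) (1 + k) e := by
      exact_mod_cast (by omega : (needing π S e (u + 1 + k)).card + k ≤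
        (needing π S e u).card + load π (u + 1) (1 + k) e)
    push_cast at h4 ⊢
    linarith

end Needing

/-! ### Stability of the ring -/

section Stability

variable {n c : ℕ} {π : Traffic (Link n c)} {S : Schedule (Link n c)}

/-- Every route follows a single ring. -/
def FollowsRings (π : Traffic (Link n c)) : Prop :=
  ∀ t, ∀ path ∈ π t, ∃ (p : Packet n) (j : Fin c), path = ringRoute p j

theorem FollowsRings.routeOf_eq_nil_or (h : FollowsRings π) (i : PacketId) :
    routeOf π i = [] ∨ ∃ (p : Packet n) (j : Fin c), routeOf π i = ringRoute p j := by
  rcases hk : (π i.1)[i.2]? with _ | path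
  · exact Or.inl (by simp [routeOf, hk])
  · obtain ⟨p, j, rfl⟩ := h i.1 path (List.mem_of_getElem? hk)
    exact Or.inr ⟨p, j, by simp [routeOf, hk]⟩

/-- In `Packet.hops` the cast to `ZMod n` acts on the range through a monadic bind; this is the form
with a plain map. -/
theorem hops_eq (p : Packet n) :
    p.hops = (List.range (p.dst - p.src).val).map fun k : ℕ => p.src + (k : ZMod n) := by
  rw [Packet.hops]
  simp only [List.pure_def, List.bind_eq_flatMap, ← List.map_eq_flatMap, List.map_map]
  rfl

theorem length_hops (p : Packet n) : p.hops.length = (p.dst - p.src).val := by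
  simp [hops_eq]

theorem length_ringRoute (p : Packet n) (j : Fin c) :
    (ringRoute p j).length = (p.dst - p.src).val := by
  simp [ringRoute, length_hops]

theorem ringRoute_getElem? (p : Packet n) (j : Fin c) (k : ℕ) :
    (ringRoute p j)[k]? =
      if k < (p.dst - p.src).val then some (p.src + (k : ZMod n), j) else none := by
  by_cases hk : k < (p.dst - p.src).val <;> simp [ringRoute, hops_eq, hk]

theorem natCast_inj_of_lt [NeZero n] {k l : ℕ} (hk : k < n) (hl : l < n)
    (h : (k : ZMod n) = l) : k = l := by
  have := congrArg ZMod.val h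
  rwa [ZMod.val_natCast_of_lt hk, ZMod.val_natCast_of_lt hl] at this

theorem nodup_hops [NeZero n] (p : Packet n) : p.hops.Nodup := by
  rw [hops_eq]
  refine List.Nodup.map_on ?_ List.nodup_range
  intro k hk l hl h
  have hn := ZMod.val_lt (p.dst - p.src)
  rw [List.mem_range] at hk hl
  exact natCast_inj_of_lt (by omega) (by omega) (add_left_cancel h)

theorem nodup_ringRoute [NeZero n] (p : Packet n) (j : Fin c) : (ringRoute p j).Nodup :=
  (nodup_hops p).map fun _ _ h => (Prod.mk.inj h).1

theorem FollowsRings.nodup_routeOf [NeZero n] (h : FollowsRings π) (i : PacketId) :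
    (routeOf π i).Nodup := by
  rcases h.routeOf_eq_nil_or i with h | ⟨p, j, h⟩ <;> rw [h]
  exacts [List.nodup_nil, nodup_ringRoute p j]

theorem FollowsRings.length_routeOf_lt [NeZero n] (h : FollowsRings π) (i : PacketId) :
    (routeOf π i).length < n := by
  rcases h.routeOf_eq_nil_or i with h | ⟨p, j, h⟩ <;> rw [h]
  · exact NeZero.pos n
  · rw [length_ringRoute]
    exact ZMod.val_lt _

/-- A packet that needs an idle link also needs the preceding link. -/
theorem FollowsRings.needing_pred (h : FollowsRings π) {a : ZMod n} {j : Fin c} {s : ℕ}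
    {i : PacketId} (hi : i ∈ needing π S (a, j) s) (hidle : ¬ ∃ i, Waiting π S s (a, j) i) :
    i ∈ needing π S (a - 1, j) s := by
  rw [mem_needing] at hi ⊢
  refine ⟨hi.1, ?_⟩
  obtain ⟨k, hk⟩ := List.mem_iff_getElem?.1 hi.2
  rw [List.getElem?_drop] at hk
  rcases k with _ | k
  · exact absurd ⟨i, hi.1, hk⟩ hidle
  refine List.mem_iff_getElem?.2 ⟨k, ?_⟩
  rw [List.getElem?_drop]
  rcases h.routeOf_eq_nil_or i with h | ⟨p, j', h⟩
  · simp [h] at hk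
  · rw [h, ringRoute_getElem?] at hk ⊢
    split_ifs at hk with h1
    rw [if_pos (by omega)]
    simp only [Option.some.injEq, Prod.mk.injEq] at hk ⊢
    refine ⟨?_, hk.2⟩
    rw [← hk.1]
    push_cast
    ring

/-- Each round goes back to the last idle step of the current link and passes to its predecessor,
which the same packets need at that moment. The last clause records the links passed, for packets
old enough to be present at u: a link needed later was needed at u already. -/
theorem FollowsRings.chain [NeZero n] (h : FollowsRings π) (hS : IsGreedy π S) {δ b : ℝ}
    (hδ : 0 < δ) (hb0 : 0 ≤ b) (hb : ∀ a T e, (load π a T e : ℝ) ≤ T * (1 - δ) + b) (a : ZMod n)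
    (j : Fin c) (t m : ℕ) :
    ((needing π S (a, j) t).card : ℝ) ≤ m * (b + 1) ∨
      ∃ u ≤ t, ((needing π S (a, j) t).card : ℝ) ≤
          (needing π S (a - (m : ZMod n), j) u).card + m * (b + 1) - δ * (t - u) ∧
        ∀ i ∈ needing π S (a, j) t, i.1 ≤ u →
          ∀ l ≤ m, i ∈ needing π S (a - (l : ZMod n), j) u := by
  induction m with
  | zero =>
    refine Or.inr ⟨t, le_rfl, by simp, fun i hi _ l hl => ?_⟩
    simpa [Nat.le_zero.1 hl] using hi
  | succ m ih =>
    rcases ih with ih | ⟨u, hu, hN, hP⟩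
    · left
      push_cast
      linarith
    have hsub : ∀ v, (¬ ∃ i, Waiting π S v (a - (m : ZMod n), j) i) →
        ∀ i ∈ needing π S (a - (m : ZMod n), j) v,
          i ∈ needing π S (a - ((m + 1 : ℕ) : ZMod n), j) v := by
      intro v hv i hi
      have := h.needing_pred hi hv
      rwa [sub_sub, ← Nat.cast_succ] at this
    have hnn : 0 ≤ δ * ((t : ℝ) - u) :=
      mul_nonneg hδ.le (sub_nonneg.2 (by exact_mod_cast hu))
    rcases card_needing_le_last_idle hS h.nodup_routeOf hδ hb0 hb (a - (m : ZMod n), j) u with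
      h1 | ⟨v, hv, hidle, h1⟩
    · left
      push_cast
      linarith
    · refine Or.inr ⟨v, hv.trans hu, ?_, ?_⟩
      · have h2 : ((needing π S (a - (m : ZMod n), j) v).card : ℝ) ≤
            (needing π S (a - ((m + 1 : ℕ) : ZMod n), j) v).card := by
          exact_mod_cast Finset.card_le_card (hsub v hidle)
        push_cast at h2 ⊢
        linarith
      · intro i hi hiv l hl
        have h3 := hP i hi (hiv.trans hv)
        rcases Nat.le_succ_iff.1 hl with hl | rfl
        · exact mem_needing_of_le (h3 l hl) hiv hv
        · exact hsub v hidle i (mem_needing_of_le (h3 m le_rfl) hiv hv)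

/-- No packet needs all links of a single ring. -/
theorem FollowsRings.exists_not_mem_needing [NeZero n] (h : FollowsRings π) (i : PacketId)
    (a : ZMod n) (j : Fin c) (s : ℕ) : ∃ l ≤ n, i ∉ needing π S (a - (l : ZMod n), j) s := by
  by_contra! hcon
  have hall : ∀ x : ZMod n, (x, j) ∈ routeOf π i := by
    intro x
    have h1 := hcon (a - x).val (ZMod.val_lt _).le
    rw [ZMod.natCast_zmod_val, sub_sub_cancel, mem_needing] at h1
    exact List.mem_of_mem_drop h1.2
  have h1 : (Finset.univ.image fun x : ZMod n => (x, j)) ⊆ (routeOf π i).toFinset := by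
    intro y hy
    obtain ⟨x, -, rfl⟩ := Finset.mem_image.1 hy
    exact List.mem_toFinset.2 (hall x)
  have h2 := Finset.card_le_card h1
  rw [Finset.card_image_of_injective _ (fun _ _ h => (Prod.mk.inj h).1), Finset.card_univ,
    ZMod.card] at h2
  exact absurd (h2.trans (List.toFinset_card_le _)) (not_le.2 (h.length_routeOf_lt i))

theorem FollowsRings.card_needing_le [NeZero n] (h : FollowsRings π) (hS : IsGreedy π S)
    {δ b : ℝ} (hδ : 0 < δ) (hb0 : 0 ≤ b)
    (hb : ∀ a T e, (load π a T e : ℝ) ≤ T * (1 - δ) + b) (e : Link n c) (t : ℕ) :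
    ((needing π S e t).card : ℝ) ≤ n * (b + 1) / δ + n * (b + 1) + b := by
  have hnb : 0 ≤ n * (b + 1) := by positivity
  have hnd : 0 ≤ n * (b + 1) / δ := by positivity
  induction t using Nat.strong_induction_on generalizing e with
  | _ t ih =>
  obtain ⟨a, j⟩ := e
  rcases h.chain hS hδ hb0 hb a j t n with h1 | ⟨u, hu, hN, hP⟩
  · linarith
  have hut : (u : ℝ) ≤ t := by exact_mod_cast hu
  -- In the first case the drift outweighs the n additive losses, and the count at t is at most the
  -- count at u < t for the same link, since a - n = a.
  by_cases hcase : u < t ∧ n * (b + 1) ≤ δ * (t - u)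
  · have := ih u hcase.1 (a - (n : ZMod n), j)
    linarith
  have hτ : (t : ℝ) - u ≤ n * (b + 1) / δ := by
    rcases hu.eq_or_lt with rfl | hlt
    · simpa using hnd
    · rw [le_div_iff₀ hδ]
      have : ¬ n * (b + 1) ≤ δ * (t - u) := fun h' => hcase ⟨hlt, h'⟩
      linarith
  obtain ⟨k, rfl⟩ : ∃ k, t = u + k := ⟨t - u, by omega⟩
  -- A packet injected by step u would have needed all links of the ring at u, but routes have fewer
  -- than n links.
  have hsub : needing π S (a, j) (u + k) ⊆ users π (u + 1) (u + 1 + k) (a, j) := by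
    intro i hi
    have hi' := mem_needing.1 hi
    refine mem_users.2 ⟨⟨?_, by omega⟩, List.mem_of_mem_drop hi'.2⟩
    by_contra hlt
    obtain ⟨l, hl, hl'⟩ := h.exists_not_mem_needing (S := S) i a j u
    exact hl' (hP i hi (by omega) l hl)
  have h2 : ((needing π S (a, j) (u + k)).card : ℝ) ≤ load π (u + 1) k (a, j) := by
    exact_mod_cast (Finset.card_le_card hsub).trans (card_users_le _ _ _)
  have h3 := hb (u + 1) k (a, j)
  push_cast at hτ
  nlinarith [(Nat.cast_nonneg k : (0 : ℝ) ≤ k)]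

/-- A packet stuck for D steps keeps its link busy, but at most C + D(1-δ) + b packets are there to
be served, fewer than D. -/
theorem FollowsRings.progress_increases [NeZero n] (h : FollowsRings π) (hS : IsGreedy π S)
    {δ b C : ℝ} (hb : ∀ a T e, (load π a T e : ℝ) ≤ T * (1 - δ) + b)
    (hC : ∀ e t, ((needing π S e t).card : ℝ) ≤ C) {D : ℕ} (hD : C + b < δ * D) {i : PacketId}
    {s : ℕ} (his : i.1 ≤ s) (hlt : progress π S i s < (routeOf π i).length) :
    progress π S i s + 1 ≤ progress π S i (s + D) := by
  by_contra hcon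
  have hconst : ∀ s', s ≤ s' → s' ≤ s + D → progress π S i s' = progress π S i s := by
    intro s' h1 h2
    have h3 := progress_monotone (π := π) (S := S) i h1
    have h4 := progress_monotone (π := π) (S := S) i h2
    omega
  have hbusy := card_needing_add_of_busy (u := s) (k := D)
    (e := (routeOf π i)[progress π S i s]) hS h.nodup_routeOf fun s' h1 h2 =>
      ⟨i, by omega, by rw [hconst s' h1 (by omega)]; exact List.getElem?_eq_getElem hlt⟩
  have h1 : (D : ℝ) ≤ (needing π S (routeOf π i)[progress π S i s] s).card +
      load π (s + 1) D (routeOf π i)[progress π S i s] := by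
    exact_mod_cast (Nat.le_add_left _ _).trans hbusy
  have h2 := hC (routeOf π i)[progress π S i s] s
  have h3 := hb (s + 1) D (routeOf π i)[progress π S i s]
  linarith

/-- The ring is stable under every greedy schedule. -/
theorem exists_boundedBy (n c : ℕ) [NeZero n] {W : ℕ} (hW : 0 < W) {δ : ℝ} (hδ : 0 < δ)
    (hδ1 : δ ≤ 1) : ∃ B : ℕ, ∀ π : Traffic (Link n c), FollowsRings π →
      WeaklyAdmissible W (1 - δ) π → ∀ S, IsGreedy π S → BoundedBy π S B := by
  set b : ℝ := 2 * W
  have hb0 : 0 ≤ b := by positivity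
  obtain ⟨C, hC⟩ := exists_nat_ge (n * (b + 1) / δ + n * (b + 1) + b)
  obtain ⟨D, hD⟩ := exists_nat_gt (((C : ℝ) + b) / δ)
  rw [div_lt_iff₀' hδ] at hD
  -- At most C packets need each of the n c links, and each of the fewer than n hops of a route
  -- takes at most D steps.
  refine ⟨n * c * C + n * D, fun π hπ hadm S hS => ?_⟩
  have hb : ∀ a T e, (load π a T e : ℝ) ≤ T * (1 - δ) + b :=
    fun a T e => hadm.load_le hW (by linarith) (by linarith) a T e
  have hcard : ∀ e t, ((needing π S e t).card : ℝ) ≤ C :=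
    fun e t => (hπ.card_needing_le hS hδ hb0 hb e t).trans hC
  constructor
  · intro s
    have hsub : inNetwork π S s ⊆
        ((Finset.univ.biUnion fun e => needing π S e s : Finset PacketId) : Set PacketId) := by
      rintro i ⟨e, he⟩
      exact Finset.mem_coe.2 (Finset.mem_biUnion.2 ⟨e, Finset.mem_univ _, he.mem_needing⟩)
    refine (Set.encard_le_encard hsub).trans ?_
    rw [Set.encard_coe_eq_coe_finsetCard]
    have h1 : (Finset.univ.biUnion fun e => needing π S e s).card ≤ n * c * C := by
      refine (Finset.card_biUnion_le_card_mul _ _ C fun e _ => ?_).trans ?_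
      · exact_mod_cast hcard e s
      · simp [ZMod.card]
    exact_mod_cast h1.trans (Nat.le_add_right _ _)
  · intro i
    have hm : ∀ m : ℕ, min m (routeOf π i).length ≤ progress π S i (i.1 + m * D) := by
      intro m
      induction m with
      | zero => simp
      | succ m ih =>
        have hmono := progress_monotone (π := π) (S := S) i
          (show i.1 + m * D ≤ i.1 + m * D + D by omega)
        rw [Nat.succ_mul, ← add_assoc]
        by_cases hlt : progress π S i (i.1 + m * D) < (routeOf π i).length
        · have := hπ.progress_increases hS hb hcard hD (Nat.le_add_right i.1 (m * D)) hlt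
          omega
        · omega
    have h1 := hm n
    have h2 := hπ.length_routeOf_lt i
    have h3 := progress_monotone (π := π) (S := S) i
      (show i.1 + n * D ≤ i.1 + (n * c * C + n * D) by omega)
    omega

end Stability

/-! ### Walks in the ring -/

section Walks

variable {n c : ℕ}

theorem isWalk_iff {s d : ZMod n} {π : List (Link n c)} :
    IsWalk s π d ↔ (π.map Prod.fst = (List.range π.length).map fun k : ℕ => s + (k : ZMod n)) ∧
      d = s + (π.length : ZMod n) := by
  induction π generalizing s with
  | nil => simp [IsWalk, eq_comm]
  | cons e π ih =>
    have h1 : (List.range (e :: π).length).map (fun k : ℕ => s + (k : ZMod n)) =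
        s :: (List.range π.length).map fun k : ℕ => s + 1 + (k : ZMod n) := by
      rw [List.length_cons, List.range_succ_eq_map, List.map_cons, List.map_map]
      simp [Function.comp_def, add_comm, add_left_comm]
    rw [h1, IsWalk, List.map_cons, List.cons.injEq, and_assoc]
    refine and_congr_right fun he => ?_
    rw [ih, he, List.length_cons]
    push_cast
    rw [add_assoc s 1, add_comm (1 : ZMod n) (π.length : ZMod n)]

theorem IsWalk.nodes_eq {s d : ZMod n} {π : List (Link n c)} (h : IsWalk s π d) :
    (s :: π.map fun e => e.1 + 1) =
      (List.range (π.length + 1)).map fun k : ℕ => s + (k : ZMod n) := by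
  have h1 : (π.map fun e => e.1 + 1) = (π.map Prod.fst).map (· + 1) := by simp
  rw [h1, (isWalk_iff.1 h).1, List.range_succ_eq_map]
  simp [Function.comp_def, add_assoc]

theorem nodup_map_add_natCast [NeZero n] {m : ℕ} (hm : m ≤ n) (s : ZMod n) :
    ((List.range m).map fun k : ℕ => s + (k : ZMod n)).Nodup := by
  refine List.Nodup.map_on ?_ List.nodup_range
  intro k hk l hl h
  rw [List.mem_range] at hk hl
  exact natCast_inj_of_lt (by omega) (by omega) (add_left_cancel h)

/-- Simplicity keeps the length below n, so its residue mod n determines it; the adversary is free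
only in the labels. -/
theorem IsPathOf.map_fst_eq_hops [NeZero n] {p : Packet n} {π : List (Link n c)}
    (h : IsPathOf p π) : π.map Prod.fst = p.hops := by
  obtain ⟨h1, h2⟩ := isWalk_iff.1 h.1
  have h3 := h.2.length_le_card
  rw [List.length_cons, List.length_map, ZMod.card] at h3
  rw [hops_eq, h2, add_sub_cancel_left, ZMod.val_natCast_of_lt (by omega), h1]

theorem isPathOf_ringRoute [NeZero n] (p : Packet n) (j : Fin c) :
    IsPathOf p (ringRoute p j) := by
  have h : IsWalk p.src (ringRoute p j) p.dst := by
    rw [isWalk_iff, length_ringRoute]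
    refine ⟨?_, ?_⟩
    · simp [ringRoute, hops_eq]
    · simp
  refine ⟨h, ?_⟩
  rw [h.nodes_eq, length_ringRoute]
  exact nodup_map_add_natCast (ZMod.val_lt _) _

theorem mem_ringRoute {p : Packet n} {i j : Fin c} {a : ZMod n} :
    (a, i) ∈ ringRoute p j ↔ a ∈ p.hops ∧ i = j := by
  simp [ringRoute, eq_comm]

/-- At most `c T r` packets cross from `a` to `a + 1`. -/
theorem countP_hops_le [NeZero n] {ps : List (Packet n)} {πs : List (List (Link n c))}
    (h : List.Forall₂ IsPathOf ps πs) (a : ZMod n) :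
    (ps.countP fun p => a ∈ p.hops) ≤ ∑ j : Fin c, πs.countP fun path => (a, j) ∈ path := by
  induction h with
  | nil => simp
  | @cons p path ps πs hp _ ih =>
    simp only [List.countP_cons, Finset.sum_add_distrib]
    refine Nat.add_le_add ih ?_
    split_ifs with ha
    · rw [decide_eq_true_eq, ← hp.map_fst_eq_hops, List.mem_map] at ha
      obtain ⟨⟨_, j⟩, he, rfl⟩ := ha
      refine le_trans ?_ (Finset.single_le_sum (fun _ _ => Nat.zero_le _) (Finset.mem_univ j))
      simp [he]
    · exact Nat.zero_le _

/-- The number of packets injected during the `T` steps from `t₀` on that cross from `a` to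
`a + 1`. -/
def crossings (inj : Injections n) (t₀ T : ℕ) (a : ZMod n) : ℕ :=
  ∑ t ∈ Finset.Ico t₀ (t₀ + T), (inj t).countP fun p => a ∈ p.hops

theorem AdmissibleInjections.crossings_le [NeZero n] {w : ℕ} {r : ℝ} {inj : Injections n}
    (h : AdmissibleInjections c w r inj) {T : ℕ} (hT : w ≤ T) (t₀ : ℕ) (a : ZMod n) :
    crossings inj t₀ T a ≤ ⌊(c : ℝ) * r * T⌋₊ := by
  obtain ⟨π, hπ, hadm⟩ := h
  have h1 : crossings inj t₀ T a ≤ ∑ j : Fin c, load π t₀ T (a, j) := by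
    simp only [crossings, load]
    rw [Finset.sum_comm]
    refine Finset.sum_le_sum fun t _ => (countP_hops_le (hπ t) a).trans (le_of_eq ?_)
    exact Finset.sum_congr rfl fun j _ => List.countP_congr fun x _ => by simp
  refine Nat.le_floor ?_
  calc (crossings inj t₀ T a : ℝ) ≤ ∑ j : Fin c, (load π t₀ T (a, j) : ℝ) := by
        exact_mod_cast h1
    _ ≤ ∑ _j : Fin c, (T : ℝ) * r := Finset.sum_le_sum fun j _ => hadm T hT t₀ (a, j)
    _ = c * r * T := by simp; ring

end Walks

/-! ### The estimator -/

section Estimator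

variable {n c : ℕ}

theorem weight_pos {ε : ℝ} (hε : 0 ≤ ε) (e : Link n c) (p : Packet n) (j : Fin c) :
    0 < weight ε e p j :=
  pow_pos (by linarith) _

theorem condWeight_pos {ε : ℝ} (hε : 0 ≤ ε) (hc : 0 < c) (e : Link n c)
    (x : Packet n × Option (Fin c)) : 0 < condWeight ε e x := by
  rcases x with ⟨p, _ | j⟩
  · have : (Finset.univ : Finset (Fin c)).Nonempty := ⟨⟨0, hc⟩, Finset.mem_univ _⟩
    have hc' : (0 : ℝ) < c := by exact_mod_cast hc
    exact div_pos (Finset.sum_pos (fun j _ => weight_pos hε e p j) this) hc'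
  · exact weight_pos hε e p j

/-- Exactly one of the c rings contains the link, so a packet crossing it has mean weight 1 + ε/c,
independently of the label and of the rest of its route. -/
theorem condWeight_none {ε : ℝ} (hc : 0 < c) (a : ZMod n) (i : Fin c) (p : Packet n) :
    condWeight ε (a, i) (p, none) = if a ∈ p.hops then 1 + ε / c else 1 := by
  have hc' : (c : ℝ) ≠ 0 := by exact_mod_cast hc.ne'
  simp only [condWeight, weight, mem_ringRoute]
  split_ifs with ha
  · have h1 : ∀ j : Fin c, (1 + ε) ^ (if a ∈ p.hops ∧ i = j then 1 else 0) =
        1 + if i = j then ε else 0 := by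
      intro j
      by_cases hij : i = j <;> simp [ha, hij]
    rw [Finset.sum_congr rfl fun j _ => h1 j, Finset.sum_add_distrib]
    simp
    field_simp
  · simp [ha, hc']

/-- The expected weight of a packet from `a` to `a + 1` at a link from `a` to `a + 1`. -/
def ghostWeight (n c : ℕ) (ε : ℝ) : ℝ := if n = 1 then 1 else 1 + ε / c

theorem mem_hops_unit [NeZero n] {a b : ZMod n} :
    a ∈ (⟨b, b + 1⟩ : Packet n).hops ↔ n ≠ 1 ∧ b = a := by
  rw [hops_eq]
  simp only [add_sub_cancel_left]
  rcases eq_or_ne n 1 with rfl | hn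
  · have : (1 : ZMod 1).val = 0 := rfl
    simp [this]
  · have h1 : 1 < n := by have := NeZero.pos n; omega
    have : Fact (1 < n) := ⟨h1⟩
    rw [ZMod.val_one]
    simp [hn, eq_comm]

/-- A real packet weighs as much as a ghost at each hop. For n = 1 no packet crosses any hop, so the
special value 1 is harmless. -/
theorem condWeight_none_eq_ghostWeight [NeZero n] {ε : ℝ} (hc : 0 < c) (a : ZMod n) (i : Fin c)
    (p : Packet n) :
    condWeight ε (a, i) (p, none) = if a ∈ p.hops then ghostWeight n c ε else 1 := by
  rw [condWeight_none hc, ghostWeight]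
  by_cases hn : n = 1
  · subst hn
    have : p.hops = [] := by
      have h1 := ZMod.val_lt (p.dst - p.src)
      have h2 : (p.dst - p.src).val = 0 := by omega
      rw [hops_eq, h2]
      rfl
    simp [this]
  · simp [hn]

theorem condWeight_ghost [NeZero n] {ε : ℝ} (hc : 0 < c) (a b : ZMod n) (i : Fin c) :
    condWeight ε (a, i) (⟨b, b + 1⟩, none) = if b = a then ghostWeight n c ε else 1 := by
  rw [condWeight_none hc, ghostWeight]
  simp only [mem_hops_unit]
  by_cases hn : n = 1 <;> by_cases hb : b = a <;> simp [hn, hb]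

theorem one_le_ghostWeight {ε : ℝ} (hε : 0 ≤ ε) : 1 ≤ ghostWeight n c ε := by
  rw [ghostWeight]
  split_ifs
  · exact le_rfl
  · have : 0 ≤ ε / c := by positivity
    linarith

theorem ghostWeight_le_exp {ε : ℝ} (hε : 0 ≤ ε) : ghostWeight n c ε ≤ Real.exp (ε / c) := by
  have h : 0 ≤ ε / c := by positivity
  have := Real.add_one_le_exp (ε / c)
  rw [ghostWeight]
  split_ifs <;> linarith

theorem prod_condWeight_ghosts [NeZero n] {ε r : ℝ} {W : ℕ} (hc : 0 < c) (a : ZMod n) (i : Fin c)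
    (ps : List (Packet n)) :
    (((ghosts c r W ps).map fun g => (g, (none : Option (Fin c)))).map
      (condWeight ε (a, i))).prod =
      ghostWeight n c ε ^ (⌊(c : ℝ) * r * W⌋₊ - ps.countP fun p => a ∈ p.hops) := by
  have h1 : ((ghosts c r W ps).map fun g => (g, (none : Option (Fin c)))).map
      (condWeight ε (a, i)) = ∑ b : ZMod n, Multiset.replicate
        (⌊(c : ℝ) * r * W⌋₊ - ps.countP fun p => b ∈ p.hops)
        (if b = a then ghostWeight n c ε else 1) := by
    rw [Multiset.map_map, ghosts, ← Multiset.coe_mapAddMonoidHom, map_sum]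
    refine Finset.sum_congr rfl fun b _ => ?_
    rw [Multiset.coe_mapAddMonoidHom, Multiset.map_replicate, Function.comp_apply,
      condWeight_ghost hc]
  rw [h1, Multiset.prod_sum]
  simp only [Multiset.prod_replicate]
  rw [Finset.prod_eq_single a]
  · simp
  · intro b _ hb
    simp [hb]
  · simp

/-- The routed packets `L` and the remaining ghost packets. -/
def routedPool [NeZero n] (r : ℝ) (W : ℕ) (L : List (Packet n × Fin c)) :
    Multiset (Packet n × Option (Fin c)) :=
  ((L.map fun x => (x.1, some x.2) : List (Packet n × Option (Fin c))) : Multiset _) +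
    (ghosts c r W (L.map Prod.fst)).map fun g => (g, none)

/-- The value of the estimator after the packets of `L` have been routed. -/
def potential [NeZero n] (r : ℝ) (W : ℕ) (L : List (Packet n × Fin c)) : ℝ :=
  estimator r W (routedPool r W L)

/-- The routed packets of the current window. -/
def routed (W t : ℕ) (log : Log n c) : List (Packet n × Fin c) :=
  (currentWindow W t log).map Prod.snd

theorem estimator_pool_some [NeZero n] (r : ℝ) (W t : ℕ) (log : Log n c) (p : Packet n)
    (j : Fin c) : estimator r W (pool r W t log p (some j)) =
      potential r W (routed W t log ++ [(p, j)]) := by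
  rw [potential, routedPool, pool, routed]
  congr 2
  · simp only [List.map_append, List.map_map, ← Multiset.coe_add]
    rfl
  · simp only [List.map_append, List.map_map]
    rfl

/-- Per hop of p, one factor for a ghost becomes an equal factor for p. The bound on the crossings
keeps the natural subtraction in `ghosts` from truncating, that is, a ghost is there to be replaced.
-/
theorem estimator_pool_none [NeZero n] {r : ℝ} {W t : ℕ} (hc : 0 < c) (log : Log n c)
    (p : Packet n)
    (h : ∀ a, ((routed W t log).map Prod.fst ++ [p]).countP (fun p => a ∈ p.hops) ≤
      ⌊(c : ℝ) * r * W⌋₊) :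
    estimator r W (pool r W t log p none) = potential r W (routed W t log) := by
  unfold potential estimator routedPool
  refine Finset.sum_congr rfl fun e _ => ?_
  obtain ⟨a, i⟩ := e
  congr 1
  have h1 : (currentWindow W t log).map (fun x => x.2.1) = (routed W t log).map Prod.fst := by
    simp [routed, Function.comp_def]
  have h2 : (currentWindow W t log).map (fun x => (x.2.1, some x.2.2)) =
      (routed W t log).map fun x => (x.1, some x.2) := by
    simp [routed, Function.comp_def]
  rw [pool, h1, h2, Multiset.map_add, Multiset.map_add, Multiset.map_add, Multiset.prod_add,
    Multiset.prod_add, Multiset.prod_add, prod_condWeight_ghosts hc, prod_condWeight_ghosts hc,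
    mul_assoc]
  congr 1
  have h3 := h a
  rw [List.countP_append] at h3 ⊢
  rw [Multiset.map_singleton, Multiset.prod_singleton, condWeight_none_eq_ghostWeight hc]
  by_cases ha : a ∈ p.hops
  · simp only [List.countP_singleton, ha, decide_true, if_true] at h3 ⊢
    rw [← pow_succ']
    congr 1
    omega
  · simp [ha]

/-- The average over the choices of a single ring is the value before the choice. -/
theorem exists_estimator_pool_le [NeZero n] (r : ℝ) (W t : ℕ) (hc : 0 < c) (log : Log n c)
    (p : Packet n) : ∃ j : Fin c, estimator r W (pool r W t log p (some j)) ≤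
      estimator r W (pool r W t log p none) := by
  have hc' : (0 : ℝ) < c := by exact_mod_cast hc
  have havg : ∑ j : Fin c, estimator r W (pool r W t log p (some j)) =
      ∑ _j : Fin c, estimator r W (pool r W t log p none) := by
    rw [Finset.sum_const, Finset.card_univ, Fintype.card_fin, nsmul_eq_mul]
    simp only [estimator, pool, Multiset.map_add, Multiset.prod_add, Multiset.map_singleton,
      Multiset.prod_singleton]
    rw [Finset.sum_comm, Finset.mul_sum]
    refine Finset.sum_congr rfl fun e _ => ?_
    simp only [condWeight]
    rw [← Finset.sum_div, ← Finset.sum_mul, ← Finset.mul_sum]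
    field_simp
  obtain ⟨j, -, hj⟩ := Finset.exists_le_of_sum_le ⟨⟨0, hc⟩, Finset.mem_univ _⟩ havg.le
  exact ⟨j, hj⟩

theorem exists_followsEstimator [NeZero n] (r : ℝ) (W : ℕ) (hc : 0 < c) :
    ∃ A : OnlineRouter n c, FollowsEstimator r W A := by
  choose A hA using fun t (log : Log n c) (p : Packet n) =>
    exists_estimator_pool_le r W t hc log p
  exact ⟨A, hA⟩

/-- A Chernoff-type bound for the exponent. -/
theorem chernoff_exponent {ε : ℝ} (h0 : 0 ≤ ε) (h1 : ε ≤ 1) :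
    ε ^ 2 / 3 ≤ (1 + ε) * Real.log (1 + ε) - ε := by
  -- With ln(1+ε) ≥ 2ε/(2+ε) the right-hand side is at least ε²/(2+ε), and 2 + ε ≤ 3.
  have h2 := Real.le_log_one_add_of_nonneg h0
  have h3 : (1 + ε) * (2 * ε / (ε + 2)) ≤ (1 + ε) * Real.log (1 + ε) := by gcongr
  have h4 : (1 + ε) * (2 * ε / (ε + 2)) - ε = ε ^ 2 / (ε + 2) := by
    field_simp
    ring
  have h5 : ε ^ 2 / 3 ≤ ε ^ 2 / (ε + 2) := by
    apply div_le_div_of_nonneg_left <;> nlinarith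
  linarith

theorem log_le_windowLength {r β : ℝ} (hr : 0 < r) (hr1 : r < 1) :
    Real.log (n * c / β) ≤ r * windowLength n c r β * (1 - r) ^ 2 / 3 := by
  have h : 3 / (r * (1 - r) ^ 2) * Real.log (n * c / β) ≤ windowLength n c r β := Nat.le_ceil _
  have h1 : 0 < 1 - r := by linarith
  rw [div_mul_eq_mul_div, div_le_iff₀ (by positivity)] at h
  linarith

/-- The at most crW ghosts at a hop contribute at most exp(ε/c) each, hence exp(εrW) in all;
`chernoff_exponent` and the size of W make each of the n c quotients at most β/(nc). -/
theorem potential_nil_le [NeZero n] {r β : ℝ} (hc : 0 < c) (hr : 0 < r) (hr1 : r < 1)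
    (hβ : 0 < β) : potential (n := n) (c := c) r (windowLength n c r β) [] ≤ β := by
  set W := windowLength n c r β with hW
  have hlog := log_le_windowLength (n := n) (c := c) (β := β) hr hr1
  rw [← hW] at hlog
  have hc' : (0 : ℝ) < c := by exact_mod_cast hc
  have hn' : (0 : ℝ) < n := by exact_mod_cast NeZero.pos n
  set ε := 1 - r with hε
  have hε0 : 0 ≤ ε := by linarith
  have hterm : ∀ e : Link n c, ((routedPool r W []).map (condWeight ε e)).prod /
      (1 + ε) ^ ((1 + ε) * r * (W : ℝ)) ≤ β / (n * c) := by
    rintro ⟨a, i⟩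
    rw [routedPool, Multiset.map_add, Multiset.prod_add, prod_condWeight_ghosts hc]
    simp only [List.map_nil, Multiset.coe_nil, Multiset.map_zero, Multiset.prod_zero, one_mul,
      List.countP_nil, Nat.sub_zero]
    have h1 : ghostWeight n c ε ^ ⌊(c : ℝ) * r * W⌋₊ ≤ Real.exp (ε * r * W) := by
      calc ghostWeight n c ε ^ ⌊(c : ℝ) * r * W⌋₊
          ≤ Real.exp (ε / c) ^ ⌊(c : ℝ) * r * W⌋₊ :=
            pow_le_pow_left₀ (by linarith [one_le_ghostWeight (n := n) (c := c) hε0])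
              (ghostWeight_le_exp hε0) _
        _ = Real.exp (⌊(c : ℝ) * r * W⌋₊ * (ε / c)) := (Real.exp_nat_mul _ _).symm
        _ ≤ Real.exp (ε * r * W) := by
            apply Real.exp_le_exp.2
            have h2 : (⌊(c : ℝ) * r * W⌋₊ : ℝ) ≤ c * r * W := Nat.floor_le (by positivity)
            calc (⌊(c : ℝ) * r * W⌋₊ : ℝ) * (ε / c) ≤ c * r * W * (ε / c) := by gcongr
              _ = ε * r * W := by field_simp
    have h2 : (1 + ε) ^ ((1 + ε) * r * (W : ℝ)) =
        Real.exp (Real.log (1 + ε) * ((1 + ε) * r * W)) :=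
      Real.rpow_def_of_pos (by linarith) _
    have h3 : β / (n * c) = Real.exp (-Real.log (n * c / β)) := by
      rw [Real.exp_neg, Real.exp_log (by positivity), inv_div]
    rw [h2, h3, div_le_iff₀ (Real.exp_pos _), ← Real.exp_add]
    refine h1.trans (Real.exp_le_exp.2 ?_)
    have h4 := mul_le_mul_of_nonneg_left (chernoff_exponent hε0 (by linarith))
      (by positivity : 0 ≤ r * W)
    nlinarith
  calc potential (n := n) (c := c) r W [] ≤ ∑ _e : Link n c, β / (n * c) :=
        Finset.sum_le_sum fun e _ => hterm e
    _ = β := by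
        rw [Finset.sum_const, Finset.card_univ, Fintype.card_prod, ZMod.card, Fintype.card_fin,
          nsmul_eq_mul]
        push_cast
        field_simp

/-- All terms are nonnegative, so each is below 1. Leftover ghosts only contribute factors at least
1; dropping them leaves (1+ε)^load < (1+ε)^((1+ε)rW). -/
theorem countP_le_of_potential_lt_one [NeZero n] {r : ℝ} {W : ℕ} (hc : 0 < c) (hr1 : r < 1)
    {L : List (Packet n × Fin c)} (h : potential r W L < 1) (e : Link n c) :
    ((L.countP fun x => e ∈ ringRoute x.1 x.2 : ℕ) : ℝ) ≤ (1 + (1 - r)) * r * W := by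
  have hε0 : 0 < 1 - r := by linarith
  have hpos : 0 < (1 + (1 - r)) ^ ((1 + (1 - r)) * r * (W : ℝ)) :=
    Real.rpow_pos_of_pos (by linarith) _
  unfold potential estimator at h
  have h1 := (Finset.single_le_sum (f := fun e : Link n c =>
    ((routedPool r W L).map (condWeight (1 - r) e)).prod /
      (1 + (1 - r)) ^ ((1 + (1 - r)) * r * (W : ℝ))) ?_
      (Finset.mem_univ e)).trans_lt h
  · rw [div_lt_one hpos, routedPool, Multiset.map_add, Multiset.prod_add] at h1
    obtain ⟨a, i⟩ := e
    rw [prod_condWeight_ghosts hc, Multiset.map_coe, Multiset.prod_coe, List.map_map] at h1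
    have h2 : (L.map (condWeight (1 - r) (a, i) ∘ fun x => (x.1, some x.2))).prod =
        (1 + (1 - r)) ^ (L.countP fun x => (a, i) ∈ ringRoute x.1 x.2) := by
      clear h h1
      induction L with
      | nil => simp
      | cons x L ih =>
        rw [List.map_cons, List.prod_cons, ih, List.countP_cons, pow_add, mul_comm]
        congr 1
        simp [condWeight, weight]
    rw [h2] at h1
    have h3 := one_le_pow₀ (one_le_ghostWeight (n := n) (c := c) hε0.le)
      (n := ⌊(c : ℝ) * r * W⌋₊ - (L.map Prod.fst).countP fun p => a ∈ p.hops)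
    have h4 : (1 + (1 - r)) ^ (((L.countP fun x => (a, i) ∈ ringRoute x.1 x.2 : ℕ) : ℝ)) <
        (1 + (1 - r)) ^ ((1 + (1 - r)) * r * (W : ℝ)) := by
      rw [Real.rpow_natCast]
      refine lt_of_le_of_lt ?_ h1
      exact le_mul_of_one_le_right (by positivity) h3
    exact ((Real.rpow_lt_rpow_left_iff (by linarith)).1 h4).le
  · intro e _
    refine div_nonneg (Multiset.prod_nonneg fun x hx => ?_) hpos.le
    obtain ⟨y, -, rfl⟩ := Multiset.mem_map.1 hx
    exact (condWeight_pos hε0.le hc e y).le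

end Estimator

/-! ### Runs of an on-line algorithm -/

section Runs

variable {n c : ℕ} (A : OnlineRouter n c)

theorem map_batch (t : ℕ) (log : Log n c) (ps : List (Packet n)) :
    (A.batch t log ps).map (fun x => x.2.1) = ps := by
  induction ps generalizing log with
  | nil => rfl
  | cons p ps ih => simp [OnlineRouter.batch, ih]

theorem time_of_mem_batch {t : ℕ} {log : Log n c} {ps : List (Packet n)} {x : ℕ × Packet n × Fin c}
    (h : x ∈ A.batch t log ps) : x.1 = t := by
  induction ps generalizing log with
  | nil => simp [OnlineRouter.batch] at h
  | cons p ps ih =>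
    rw [OnlineRouter.batch, List.mem_cons] at h
    rcases h with rfl | h
    exacts [rfl, ih h]

theorem time_of_mem_log {inj : Injections n} {t : ℕ} {x : ℕ × Packet n × Fin c}
    (h : x ∈ A.log inj t) : x.1 < t := by
  induction t with
  | zero => simp [OnlineRouter.log] at h
  | succ t ih =>
    rw [OnlineRouter.log, List.mem_append] at h
    rcases h with h | h
    · exact (ih h).trans (Nat.lt_succ_self t)
    · rw [time_of_mem_batch A h]
      exact Nat.lt_succ_self t

theorem currentWindow_append (W t : ℕ) (l m : Log n c) :
    currentWindow W t (l ++ m) = currentWindow W t l ++ currentWindow W t m :=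
  List.filter_append ..

theorem currentWindow_batch (W t : ℕ) (log : Log n c) (ps : List (Packet n)) :
    currentWindow W t (A.batch t log ps) = A.batch t log ps := by
  refine List.filter_eq_self.2 fun x hx => ?_
  simp [time_of_mem_batch A hx]

theorem currentWindow_log_succ (inj : Injections n) (W t : ℕ) :
    currentWindow W t (A.log inj (t + 1)) =
      currentWindow W t (A.log inj t) ++ A.batch t (A.log inj t) (inj t) := by
  rw [OnlineRouter.log, currentWindow_append, currentWindow_batch]

theorem currentWindow_congr {W s t : ℕ} (h : s / W = t / W) (log : Log n c) :
    currentWindow W s log = currentWindow W t log := by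
  simp only [currentWindow, h]

theorem currentWindow_start (inj : Injections n) {W : ℕ} (hW : 0 < W) (k : ℕ) :
    currentWindow W (k * W) (A.log inj (k * W)) = [] := by
  refine List.filter_eq_nil_iff.2 fun x hx => ?_
  have h1 := time_of_mem_log A hx
  have h2 : x.1 / W < k := Nat.div_lt_of_lt_mul (by rwa [mul_comm])
  rw [Nat.mul_div_cancel _ hW]
  simp [h2.ne]

theorem window_div {W m k : ℕ} (hm : m < W) : (k * W + m) / W = k := by
  rw [mul_comm, Nat.mul_add_div (by omega), Nat.div_eq_of_lt hm, add_zero]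

theorem currentWindow_log_window_succ (inj : Injections n) {W m : ℕ} (k : ℕ) (hm : m < W) :
    currentWindow W (k * W) (A.log inj (k * W + (m + 1))) =
      currentWindow W (k * W) (A.log inj (k * W + m)) ++
        A.batch (k * W + m) (A.log inj (k * W + m)) (inj (k * W + m)) := by
  have h : k * W / W = (k * W + m) / W := by
    rw [window_div hm, Nat.mul_div_cancel _ (by omega)]
  rw [currentWindow_congr h, currentWindow_congr h, ← add_assoc, currentWindow_log_succ]

theorem countP_window_hops (inj : Injections n) {W m : ℕ} (hW : 0 < W) (k : ℕ) (hm : m ≤ W)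
    (a : ZMod n) :
    (((routed W (k * W) (A.log inj (k * W + m))).map Prod.fst).countP fun p => a ∈ p.hops) =
      crossings inj (k * W) m a := by
  induction m with
  | zero => simp [routed, currentWindow_start A inj hW, crossings]
  | succ m ih =>
    rw [routed, currentWindow_log_window_succ A inj k (by omega), List.map_append,
      List.map_append, List.countP_append, ← routed, ih (by omega), List.map_map]
    have h := map_batch A (k * W + m) (A.log inj (k * W + m)) (inj (k * W + m))
    rw [show (Prod.fst ∘ Prod.snd : ℕ × Packet n × Fin c → Packet n) = fun x => x.2.1 from rfl, h,
      crossings, crossings, ← add_assoc, Finset.sum_Ico_succ_top (by omega)]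

theorem load_traffic_window (inj : Injections n) {W m : ℕ} (hW : 0 < W)
    (k : ℕ) (hm : m ≤ W) (e : Link n c) :
    load (A.traffic inj) (k * W) m e =
      (routed W (k * W) (A.log inj (k * W + m))).countP fun x => e ∈ ringRoute x.1 x.2 := by
  induction m with
  | zero => simp [routed, currentWindow_start A inj hW, load]
  | succ m ih =>
    rw [routed, currentWindow_log_window_succ A inj k (by omega), List.map_append,
      List.countP_append, ← routed, ← ih (by omega), load, load, ← add_assoc,
      Finset.sum_Ico_succ_top (by omega), OnlineRouter.traffic, List.countP_map, List.countP_map]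
    congr 1
    exact List.countP_congr fun x _ => by simp

variable {A}

/-- For each packet, the exchange with ghosts preserves the estimator and the choice of the ring
does not increase it. -/
theorem FollowsEstimator.potential_batch_le [NeZero n] {r : ℝ} {W : ℕ} (hc : 0 < c)
    (hA : FollowsEstimator r W A) (t : ℕ) (θ : ℝ) (log : Log n c) (ps : List (Packet n))
    (hθ : potential r W (routed W t log) ≤ θ)
    (h : ∀ a, ((routed W t log).map Prod.fst ++ ps).countP (fun p => a ∈ p.hops) ≤
      ⌊(c : ℝ) * r * W⌋₊) :
    potential r W (routed W t (log ++ A.batch t log ps)) ≤ θ := by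
  induction ps generalizing log with
  | nil => simpa [OnlineRouter.batch] using hθ
  | cons p ps ih =>
    have hr : routed W t (log ++ [(t, p, A t log p)]) = routed W t log ++ [(p, A t log p)] := by
      simp [routed, currentWindow]
    rw [OnlineRouter.batch, List.append_cons]
    refine ih _ ?_ ?_
    · rw [hr, ← estimator_pool_some]
      refine (hA t log p).trans ((estimator_pool_none hc log p fun a => ?_).le.trans hθ)
      refine le_trans ?_ (h a)
      simp only [List.countP_append, List.countP_cons, List.countP_nil]
      omega
    · intro a
      rw [hr]
      simpa using h a

theorem FollowsEstimator.potential_window_le [NeZero n] {r β : ℝ} {w : ℕ} (hc : 0 < c)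
    (hr : 0 < r) (hr1 : r < 1) (hβ : 0 < β) (hw : w ≤ windowLength n c r β)
    (hW : 0 < windowLength n c r β) (hA : FollowsEstimator r (windowLength n c r β) A)
    {inj : Injections n} (hinj : AdmissibleInjections c w r inj) (k m : ℕ)
    (hm : m ≤ windowLength n c r β) :
    potential r (windowLength n c r β) (routed (windowLength n c r β)
      (k * windowLength n c r β) (A.log inj (k * windowLength n c r β + m))) ≤ β := by
  set W := windowLength n c r β with hWdef
  induction m with
  | zero =>
    rw [routed, add_zero, currentWindow_start A inj hW]
    exact potential_nil_le hc hr hr1 hβ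
  | succ m ih =>
    have h : k * W / W = (k * W + m) / W := by
      rw [window_div hm, Nat.mul_div_cancel _ (by omega)]
    rw [routed, ← add_assoc, OnlineRouter.log, currentWindow_congr h, ← routed]
    refine hA.potential_batch_le hc _ _ _ _ ?_ fun a => ?_
    · rw [routed, ← currentWindow_congr h]
      exact ih (by omega)
    · rw [routed, ← currentWindow_congr h, ← routed, List.countP_append,
        countP_window_hops A inj hW k (by omega)]
      -- Admissibility says nothing about short intervals, so the part of the window seen so far is
      -- enlarged to the full window, of length W ≥ w.
      refine le_trans ?_ (hinj.crossings_le hw (k * W) a)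
      rw [crossings, crossings, ← Finset.sum_Ico_succ_top (by omega)]
      exact Finset.sum_le_sum_of_subset (Finset.Ico_subset_Ico le_rfl (by omega))

theorem FollowsEstimator.weaklyAdmissible [NeZero n] {r β : ℝ} {w : ℕ} (hc : 0 < c)
    (hr : 0 < r) (hr1 : r < 1) (hβ : 0 < β) (hβ1 : β < 1) (hw : w ≤ windowLength n c r β)
    (hW : 0 < windowLength n c r β) (hA : FollowsEstimator r (windowLength n c r β) A)
    {inj : Injections n} (hinj : AdmissibleInjections c w r inj) :
    WeaklyAdmissible (windowLength n c r β) (1 - (1 - r) ^ 2) (A.traffic inj) := by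
  intro k e
  rw [load_traffic_window A inj hW k le_rfl]
  refine (countP_le_of_potential_lt_one hc hr1 ((hA.potential_window_le hc hr hr1 hβ hw hW hinj k _
    le_rfl).trans_lt hβ1) e).trans (le_of_eq ?_)
  -- As r = 1 - ε, (1+ε)r = 1 - ε².
  ring

theorem isRouting_traffic [NeZero n] (A : OnlineRouter n c) (inj : Injections n) :
    IsRouting inj (A.traffic inj) := by
  intro t
  have h : ∀ l : Log n c, List.Forall₂ IsPathOf (l.map fun x => x.2.1)
      (l.map fun x => ringRoute x.2.1 x.2.2) := by
    intro l
    induction l with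
    | nil => exact .nil
    | cons x l ih => exact .cons (isPathOf_ringRoute _ _) ih
  have h1 := h (A.batch t (A.log inj t) (inj t))
  rwa [map_batch] at h1

theorem followsRings_traffic (A : OnlineRouter n c) (inj : Injections n) :
    FollowsRings (A.traffic inj) := by
  intro t path hp
  obtain ⟨x, -, rfl⟩ := List.mem_map.1 hp
  exact ⟨_, _, rfl⟩

end Runs

/-! ### The size of the window -/

theorem windowLength_pos {n c : ℕ} [NeZero n] {r β : ℝ} (hc : 0 < c) (hr : 0 < r) (hr1 : r < 1)
    (hβ : 0 < β) (hβ1 : β < 1) : 0 < windowLength n c r β := by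
  have h1 : 0 < 1 - r := by linarith
  have h2 : (1 : ℝ) ≤ n * c := by
    exact_mod_cast Nat.one_le_iff_ne_zero.2 (mul_ne_zero (NeZero.ne n) hc.ne')
  have h3 : 1 < n * c / β := by
    rw [lt_div_iff₀ hβ]
    linarith
  have := Real.log_pos h3
  exact Nat.ceil_pos.2 (by positivity)

theorem exists_le_windowLength {n c : ℕ} [NeZero n] {r : ℝ} (w : ℕ) (hc : 0 < c) (hr : 0 < r)
    (hr1 : r < 1) : ∃ β : ℝ, 0 < β ∧ β < 1 ∧ w ≤ windowLength n c r β := by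
  have h1 : 0 < 1 - r := by linarith
  have h2 : (1 : ℝ) ≤ n * c := by
    exact_mod_cast Nat.one_le_iff_ne_zero.2 (mul_ne_zero (NeZero.ne n) hc.ne')
  -- Chosen so that 3/(rε²) · x = w + 1; then β = exp(-x) suffices, because ln(nc) ≥ 0.
  set x : ℝ := (w + 1) * (r * (1 - r) ^ 2) / 3
  have hx : 0 < x := by positivity
  refine ⟨Real.exp (-x), Real.exp_pos _, by rw [← Real.exp_zero]; exact Real.exp_lt_exp.2 (by linarith), ?_⟩
  have h3 : x ≤ Real.log (n * c / Real.exp (-x)) := by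
    rw [Real.log_div (by positivity) (Real.exp_pos _).ne', Real.log_exp]
    linarith [Real.log_nonneg h2]
  have h4 : 3 / (r * (1 - r) ^ 2) * x = w + 1 := by
    simp only [x]
    field_simp
  have h5 : (w : ℝ) ≤ 3 / (r * (1 - r) ^ 2) * Real.log (n * c / Real.exp (-x)) := by
    calc (w : ℝ) ≤ 3 / (r * (1 - r) ^ 2) * x := by linarith
      _ ≤ _ := by gcongr
  exact Nat.cast_le.1 (h5.trans (Nat.le_ceil _))

/-! ### A queueing network that realizes a FIFO schedule -/

section Queues

variable {E : Type} [DecidableEq E]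

/-- The packets that move from a link with queue `q` to the link `f`, with their remaining
routes. -/
def forwarded (q : List (PacketId × List E)) (f : E) : List (PacketId × List E) :=
  ((q.take 1).filter fun x => x.2.tail.head? = some f).map fun x => (x.1, x.2.tail)

/-- The packets injected at step `t` whose first link is `f`, with their routes. -/
def newcomers (π : Traffic E) (t : ℕ) (f : E) : List (PacketId × List E) :=
  ((π t).zipIdx.filter fun x => x.1.head? = some f).map fun x => ((t, x.2), x.1)

/-- The queue of each link in step `s`, after the injections. The packets come with
their remaining routes; `pred f` lists the links from which packets may move to `f`. -/
def fifoQueue (pred : E → List E) (π : Traffic E) : ℕ → E → List (PacketId × List E)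
  | 0, f => newcomers π 0 f
  | s + 1, f => (fifoQueue pred π s f).tail ++
      (pred f).flatMap (fun e => forwarded (fifoQueue pred π s e) f) ++ newcomers π (s + 1) f

/-- Every link forwards the first packet of its queue. -/
def fifoSchedule (pred : E → List E) (π : Traffic E) : Schedule E :=
  fun s e => (fifoQueue pred π s e).head?.map Prod.fst

/-- `pred` lists, without repetition, the links from which a packet may move to a given link. -/
structure IsPredecessorList (pred : E → List E) (π : Traffic E) : Prop where
  nodup : ∀ f, (pred f).Nodup
  mem : ∀ i k e f, (routeOf π i)[k]? = some e → (routeOf π i)[k + 1]? = some f → e ∈ pred f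

variable {π : Traffic E} {pred : E → List E}

theorem mem_forwarded {q : List (PacketId × List E)} {f : E} {x : PacketId × List E} :
    x ∈ forwarded q f ↔
      ∃ y, q.head? = some y ∧ y.2.tail.head? = some f ∧ x = (y.1, y.2.tail) := by
  cases q with
  | nil => simp [forwarded]
  | cons y q =>
    simp only [forwarded, List.take_succ_cons, List.take_zero, List.mem_map, List.mem_filter,
      List.mem_singleton, decide_eq_true_eq, List.head?_cons, Option.some.injEq]
    constructor
    · rintro ⟨z, ⟨rfl, h⟩, rfl⟩
      exact ⟨z, rfl, h, rfl⟩
    · rintro ⟨z, rfl, h, rfl⟩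
      exact ⟨y, ⟨rfl, h⟩, rfl⟩

theorem mem_newcomers {t : ℕ} {f : E} {x : PacketId × List E} :
    x ∈ newcomers π t f ↔
      x.1.1 = t ∧ x.2 = routeOf π x.1 ∧ (routeOf π x.1).head? = some f := by
  obtain ⟨⟨t', k⟩, ρ⟩ := x
  simp only [newcomers, List.mem_map, List.mem_filter, Prod.exists, List.mem_zipIdx_iff_getElem?,
    decide_eq_true_eq, Prod.mk.injEq]
  constructor
  · rintro ⟨ρ', k', ⟨h1, h2⟩, ⟨rfl, rfl⟩, rfl⟩
    simp [routeOf, h1, h2]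
  · rintro ⟨rfl, rfl, h⟩
    refine ⟨_, k, ⟨?_, h⟩, ⟨rfl, rfl⟩, rfl⟩
    rcases hk : (π t')[k]? with _ | ρ
    · simp [routeOf, hk] at h
    · simp [routeOf, hk]

theorem pairwise_newcomers (t : ℕ) (f : E) :
    (newcomers π t f).Pairwise fun x y => x.1 ≠ y.1 := by
  rw [newcomers, List.pairwise_map]
  refine List.Pairwise.filter _ ?_
  have h : ((π t).zipIdx.map Prod.snd).Nodup := by
    rw [List.zipIdx_map_snd]
    exact List.nodup_range'
  exact (List.pairwise_map.1 h).imp fun hxy h => hxy (Prod.mk.inj h).2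

/-- The queues represent the waiting packets in the order of their arrival. -/
structure QueueInvariant (pred : E → List E) (π : Traffic E) (s : ℕ) : Prop where
  mem : ∀ e x, x ∈ fifoQueue pred π s e ↔ Waiting π (fifoSchedule pred π) s e x.1 ∧
    x.2 = (routeOf π x.1).drop (progress π (fifoSchedule pred π) x.1 s)
  pairwise : ∀ e, (fifoQueue pred π s e).Pairwise fun x y =>
    arrivalTime π (fifoSchedule pred π) s x.1 ≤ arrivalTime π (fifoSchedule pred π) s y.1 ∧
      x.1 ≠ y.1

theorem QueueInvariant.exists_mem {s : ℕ} (h : QueueInvariant pred π s) {e : E} {i : PacketId}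
    (hi : Waiting π (fifoSchedule pred π) s e i) : ∃ ρ, (i, ρ) ∈ fifoQueue pred π s e :=
  ⟨(routeOf π i).drop (progress π (fifoSchedule pred π) i s), (h.mem e _).2 ⟨hi, rfl⟩⟩

theorem queueInvariant_zero : QueueInvariant pred π 0 where
  mem e x := by
    rw [fifoQueue, mem_newcomers]
    constructor
    · rintro ⟨h1, h2, h3⟩
      exact ⟨(waiting_injection h1).2 h3, by simpa [progress] using h2⟩
    · rintro ⟨h1, h2⟩
      have h3 : x.1.1 = 0 := by have := h1.1; omega
      exact ⟨h3, by simpa [progress] using h2, (waiting_injection h3).1 h1⟩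
  pairwise e := by
    rw [fifoQueue]
    refine (pairwise_newcomers 0 e).imp_of_mem fun {x y} hx hy h => ⟨?_, h⟩
    rw [arrivalTime_injection (mem_newcomers.1 hx).1, arrivalTime_injection (mem_newcomers.1 hy).1]

variable {s : ℕ}

/-- The first packet of a queue crosses the link. -/
theorem QueueInvariant.head (h : QueueInvariant pred π s) {e : E} {x : PacketId × List E}
    (hx : (fifoQueue pred π s e).head? = some x) :
    Waiting π (fifoSchedule pred π) s e x.1 ∧
      x.2 = (routeOf π x.1).drop (progress π (fifoSchedule pred π) x.1 s) ∧
      progress π (fifoSchedule pred π) x.1 (s + 1) =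
        progress π (fifoSchedule pred π) x.1 s + 1 := by
  obtain ⟨h1, h2⟩ := (h.mem e x).1 (List.mem_of_head? hx)
  exact ⟨h1, h2, progress_succ_of_crossing h1 (by simp [fifoSchedule, hx])⟩

/-- The other packets stay. -/
theorem QueueInvariant.tail (h : QueueInvariant pred π s) {e : E} {x : PacketId × List E}
    (hx : x ∈ (fifoQueue pred π s e).tail) :
    Waiting π (fifoSchedule pred π) s e x.1 ∧
      x.2 = (routeOf π x.1).drop (progress π (fifoSchedule pred π) x.1 s) ∧
      progress π (fifoSchedule pred π) x.1 (s + 1) = progress π (fifoSchedule pred π) x.1 s ∧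
      ∀ y, (fifoQueue pred π s e).head? = some y → y.1 ≠ x.1 := by
  obtain ⟨h1, h2⟩ := (h.mem e x).1 (List.mem_of_mem_tail hx)
  have h3 : ∀ y, (fifoQueue pred π s e).head? = some y → y.1 ≠ x.1 := by
    intro y hy
    have hp := h.pairwise e
    rw [List.eq_cons_of_mem_head? hy, List.pairwise_cons] at hp
    exact (hp.1 x hx).2
  refine ⟨h1, h2, progress_succ_of_not_crossing fun f hf hS => ?_, h3⟩
  rw [hf.eq_link h1, fifoSchedule, Option.map_eq_some_iff] at hS
  obtain ⟨y, hy, hyx⟩ := hS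
  exact h3 y hy hyx

/-- A packet waiting at step s + 1 is new, or has just crossed a link (then a predecessor of f), or
has stayed in the queue of f. -/
theorem QueueInvariant.mem_succ (h : QueueInvariant pred π s) (hpred : IsPredecessorList pred π)
    (f : E) (x : PacketId × List E) :
    x ∈ fifoQueue pred π (s + 1) f ↔ Waiting π (fifoSchedule pred π) (s + 1) f x.1 ∧
      x.2 = (routeOf π x.1).drop (progress π (fifoSchedule pred π) x.1 (s + 1)) := by
  rw [fifoQueue, List.mem_append, List.mem_append, List.mem_flatMap, mem_newcomers]
  constructor
  · rintro ((hx | ⟨e, -, hx⟩) | ⟨h1, h2, h3⟩)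
    · obtain ⟨h1, h2, h3, -⟩ := h.tail hx
      rw [Waiting, h3]
      exact ⟨⟨by have := h1.1; omega, h1.2⟩, h2⟩
    · obtain ⟨y, hy, hf, rfl⟩ := mem_forwarded.1 hx
      obtain ⟨h1, h2, h3⟩ := h.head hy
      rw [Waiting, h3]
      rw [h2, List.tail_drop, List.head?_drop] at hf
      have h4 := h1.1
      exact ⟨⟨h4.trans (Nat.le_succ s), hf⟩, by rw [h2, List.tail_drop]⟩
    · refine ⟨(waiting_injection h1).2 h3, ?_⟩
      rw [progress_eq_zero h1.ge, List.drop_zero, h2]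
  · rintro ⟨h1, h2⟩
    by_cases hs : x.1.1 = s + 1
    · refine Or.inr ⟨hs, ?_, (waiting_injection hs).1 h1⟩
      rwa [progress_eq_zero hs.ge, List.drop_zero] at h2
    have hs' : x.1.1 ≤ s := by have := h1.1; omega
    left
    by_cases hc : ∃ e, Waiting π (fifoSchedule pred π) s e x.1 ∧
        fifoSchedule pred π s e = some x.1
    · obtain ⟨e, hw, hS⟩ := hc
      have hp := progress_succ_of_crossing hw hS
      rw [fifoSchedule, Option.map_eq_some_iff] at hS
      obtain ⟨y, hy, hyx⟩ := hS
      obtain ⟨-, h4, -⟩ := h.head hy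
      rw [hyx] at h4
      have hnext := h1.2
      rw [hp] at hnext h2
      refine Or.inr ⟨e, hpred.mem _ _ _ _ hw.2 hnext, mem_forwarded.2 ⟨y, hy, ?_, ?_⟩⟩
      · rw [h4, List.tail_drop, List.head?_drop, hnext]
      · rw [h4, List.tail_drop, ← h2, hyx]
    · have hp := progress_succ_of_not_crossing (π := π) fun e hw hS => hc ⟨e, hw, hS⟩
      have hw : Waiting π (fifoSchedule pred π) s f x.1 := ⟨hs', by rw [← hp]; exact h1.2⟩
      have hx : x ∈ fifoQueue pred π s f := (h.mem f x).2 ⟨hw, by rw [← hp]; exact h2⟩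
      left
      rcases hq : fifoQueue pred π s f with _ | ⟨y, q⟩
      · simp [hq] at hx
      · rw [hq, List.mem_cons] at hx
        rcases hx with rfl | hx
        · exact absurd ⟨f, hw, by simp [fifoSchedule, hq]⟩ hc
        · simpa using hx

theorem QueueInvariant.forwarded_mem (h : QueueInvariant pred π s) {e f : E}
    {x : PacketId × List E} (hx : x ∈ forwarded (fifoQueue pred π s e) f) :
    Waiting π (fifoSchedule pred π) s e x.1 ∧
      arrivalTime π (fifoSchedule pred π) (s + 1) x.1 = s + 1 ∧
      ∃ y, (fifoQueue pred π s e).head? = some y ∧ y.1 = x.1 := by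
  obtain ⟨y, hy, -, rfl⟩ := mem_forwarded.1 hx
  obtain ⟨h1, -, h3⟩ := h.head hy
  exact ⟨h1, arrivalTime_succ_of_crossing h1.1 h3, y, hy, rfl⟩

/-- Packets that stay arrived by step s, forwarded and injected ones arrive at s + 1. The order
among the latter is immaterial for FIFO. No packet occurs twice because it waits for only one link
at a time. -/
theorem QueueInvariant.succ (h : QueueInvariant pred π s) (hpred : IsPredecessorList pred π) :
    QueueInvariant pred π (s + 1) where
  mem := h.mem_succ hpred
  pairwise f := by
    rw [fifoQueue]
    refine List.pairwise_append.2 ⟨List.pairwise_append.2 ⟨?_, ?_, ?_⟩, ?_, ?_⟩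
    · refine ((h.pairwise f).sublist (List.tail_sublist _)).imp_of_mem fun {x y} hx hy hxy => ?_
      rwa [arrivalTime_succ_of_waiting (h.tail hx).2.2.1,
        arrivalTime_succ_of_waiting (h.tail hy).2.2.1]
    · refine List.pairwise_flatMap.2 ⟨fun e _ => ?_, (hpred.nodup f).imp fun {e e'} hee => ?_⟩
      · refine List.Pairwise.map _ (fun _ _ h => h) (List.Pairwise.filter _ ?_)
        cases fifoQueue pred π s e <;> simp
      · intro x hx y hy
        obtain ⟨h1, h2, -⟩ := h.forwarded_mem hx
        obtain ⟨h3, h4, -⟩ := h.forwarded_mem hy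
        refine ⟨by rw [h2, h4], fun hxy => hee ?_⟩
        rw [hxy] at h1
        exact h1.eq_link h3
    · intro x hx y hy
      obtain ⟨e, -, hy⟩ := List.mem_flatMap.1 hy
      obtain ⟨h1, h2, z, hz, hzy⟩ := h.forwarded_mem hy
      obtain ⟨h3, -, -, h4⟩ := h.tail hx
      have h5 := h3.1
      refine ⟨by rw [h2]; exact arrivalTime_le (by omega), fun hxy => ?_⟩
      rw [← hxy] at h1
      rw [h1.eq_link h3] at hz
      exact h4 z hz (hzy.trans hxy.symm)
    · refine (pairwise_newcomers (s + 1) f).imp_of_mem fun {x y} hx hy h => ⟨?_, h⟩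
      rw [arrivalTime_injection (mem_newcomers.1 hx).1,
        arrivalTime_injection (mem_newcomers.1 hy).1]
    · intro x hx y hy
      have hy1 := (mem_newcomers.1 hy).1
      have hx1 : x.1.1 ≤ s := by
        rcases List.mem_append.1 hx with hx | hx
        · exact (h.tail hx).1.1
        · obtain ⟨e, -, hx⟩ := List.mem_flatMap.1 hx
          exact (h.forwarded_mem hx).1.1
      refine ⟨?_, fun hxy => ?_⟩
      · rw [arrivalTime_injection hy1]
        exact arrivalTime_le (by omega)
      · rw [hxy] at hx1
        omega

theorem IsPredecessorList.queueInvariant (hpred : IsPredecessorList pred π) (s : ℕ) :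
    QueueInvariant pred π s := by
  induction s with
  | zero => exact queueInvariant_zero
  | succ s ih => exact ih.succ hpred

theorem IsPredecessorList.isFIFO (hpred : IsPredecessorList pred π) :
    IsFIFO π (fifoSchedule pred π) := by
  refine ⟨fun s e => ⟨fun i hi => ?_, ?_⟩, fun s e i hi i' hi' => ?_⟩
  · obtain ⟨x, hx, rfl⟩ := Option.map_eq_some_iff.1 hi
    exact ((hpred.queueInvariant s).head hx).1
  · rintro ⟨i, hi⟩
    obtain ⟨ρ, hmem⟩ := (hpred.queueInvariant s).exists_mem hi
    rcases hq : fifoQueue pred π s e with _ | ⟨y, q⟩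
    · simp [hq] at hmem
    · exact ⟨y.1, by simp [fifoSchedule, hq]⟩
  · obtain ⟨x, hx, rfl⟩ := Option.map_eq_some_iff.1 hi
    obtain ⟨ρ, hmem⟩ := (hpred.queueInvariant s).exists_mem hi'
    have hp := (hpred.queueInvariant s).pairwise e
    rw [List.eq_cons_of_mem_head? hx] at hmem hp
    rcases List.mem_cons.1 hmem with h | h
    · rw [← h]
    · exact ((List.pairwise_cons.1 hp).1 _ h).1

theorem IsPredecessorList.length_le_encard (hpred : IsPredecessorList pred π) (s : ℕ) (e : E) :
    ((fifoQueue pred π s e).length : ℕ∞) ≤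
      (inNetwork π (fifoSchedule pred π) s).encard := by
  have h := hpred.queueInvariant s
  have hnd : ((fifoQueue pred π s e).map Prod.fst).Nodup :=
    List.pairwise_map.2 ((h.pairwise e).imp fun h => h.2)
  have hsub : ((((fifoQueue pred π s e).map Prod.fst).toFinset : Finset PacketId) :
      Set PacketId) ⊆ inNetwork π (fifoSchedule pred π) s := by
    intro i hi
    obtain ⟨x, hx, rfl⟩ := List.mem_map.1 (List.mem_toFinset.1 (Finset.mem_coe.1 hi))
    exact ⟨e, ((h.mem e x).1 hx).1⟩
  refine le_trans (le_of_eq ?_) (Set.encard_le_encard hsub)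
  rw [Set.encard_coe_eq_coe_finsetCard, List.toFinset_card_of_nodup hnd, List.length_map]

/-- The remaining routes of the packets that move from a link with queue `q` to the link `f`. -/
def forwardedRoutes (q : List (List E)) (f : E) : List (List E) :=
  ((q.take 1).filter fun ρ => ρ.tail.head? = some f).map List.tail

theorem map_snd_forwarded (q : List (PacketId × List E)) (f : E) :
    (forwarded q f).map Prod.snd = forwardedRoutes (q.map Prod.snd) f := by
  rw [forwarded, forwardedRoutes, ← List.map_take, List.filter_map, List.map_map, List.map_map]
  rfl

theorem map_snd_newcomers (t : ℕ) (f : E) :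
    (newcomers π t f).map Prod.snd = (π t).filter fun ρ => ρ.head? = some f := by
  conv_rhs => rw [← List.zipIdx_map_fst 0 (π t), List.filter_map]
  rw [newcomers, List.map_map]
  rfl

theorem map_snd_fifoQueue_zero (f : E) :
    (fifoQueue pred π 0 f).map Prod.snd = (π 0).filter fun ρ => ρ.head? = some f := by
  rw [fifoQueue, map_snd_newcomers]

/-- The recursion closes on the remaining routes alone, so packet identities can be forgotten when
queues are computed. -/
theorem map_snd_fifoQueue_succ (s : ℕ) (f : E) :
    (fifoQueue pred π (s + 1) f).map Prod.snd = ((fifoQueue pred π s f).map Prod.snd).tail ++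
      (pred f).flatMap (fun e => forwardedRoutes ((fifoQueue pred π s e).map Prod.snd) f) ++
        (π (s + 1)).filter fun ρ => ρ.head? = some f := by
  rw [fifoQueue, List.map_append, List.map_append, map_snd_newcomers, List.map_tail,
    List.map_flatMap]
  simp only [map_snd_forwarded]

end Queues

/-! ### An unstable ring with two parallel links -/

/-- A state of the ring with four nodes and two parallel links in which only four links are used:
two parallel ones between two others. -/
structure Config where
  /-- the tail of the first link -/
  base : ZMod 4
  /-- the number of packets that wait for the first link only -/
  short : ℕ
  /-- the number of packets that wait for the first link and continue along its ring -/
  inner : ℕ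
  /-- the number of packets that wait for the first link and continue along the other ring -/
  outer : ℕ
  /-- the queue of the next link on the same ring; `true` for packets that go on to the last link -/
  mid : List Bool
  /-- the length of the queue of the parallel link, whose packets go on to the last link -/
  side : ℕ
  /-- the length of the queue of the last link -/
  last : ℕ

namespace Config

/-- A route along a single ring. -/
def innerRoute (o : ZMod 4) : List (Link 4 2) := [(o, 0), (o + 1, 0), (o + 2, 0)]

/-- A route that changes to the other ring in the middle. -/
def outerRoute (o : ZMod 4) : List (Link 4 2) := [(o, 0), (o + 1, 1), (o + 2, 0)]

/-- The remaining routes of the packets in the queue of the link `f`. -/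
def queue (k : Config) (f : Link 4 2) : List (List (Link 4 2)) :=
  if f = (k.base, 0) then
    List.replicate k.short [(k.base, 0)] ++ List.replicate k.inner (innerRoute k.base) ++
      List.replicate k.outer (outerRoute k.base)
  else if f = (k.base + 1, 0) then
    k.mid.map fun t => if t then (innerRoute k.base).tail else [(k.base + 1, 0)]
  else if f = (k.base + 1, 1) then List.replicate k.side (outerRoute k.base).tail
  else if f = (k.base + 2, 0) then List.replicate k.last [(k.base + 2, 0)]
  else []

/-- What the adversary injects. -/
def injection (k : Config) : List (List (Link 4 2)) :=
  if 0 < k.short then [innerRoute k.base]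
  else if 0 < k.inner then [outerRoute k.base, [(k.base + 1, 0)]]
  else if 0 < k.outer then [[(k.base + 2, 0)]]
  else []

/-- The state after the injection. -/
def inject (k : Config) : Config :=
  if 0 < k.short then { k with inner := k.inner + 1 }
  else if 0 < k.inner then { k with outer := k.outer + 1, mid := k.mid ++ [false] }
  else if 0 < k.outer then { k with last := k.last + 1 }
  else k

/-- The state after every link has forwarded a packet. -/
def forward (k : Config) : Config where
  base := k.base
  short := k.short - 1
  inner := if k.short = 0 then k.inner - 1 else k.inner
  outer := if k.short = 0 ∧ k.inner = 0 then k.outer - 1 else k.outer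
  mid := k.mid.tail ++ if k.short = 0 ∧ 0 < k.inner then [true] else []
  side := k.side - 1 + if k.short = 0 ∧ k.inner = 0 ∧ 0 < k.outer then 1 else 0
  last := k.last - 1 + (if k.mid.head? = some true then 1 else 0) + if 0 < k.side then 1 else 0

/-- Only `m` packets, for the link with tail `o`. -/
def clean (o : ZMod 4) (m : ℕ) : Config := ⟨o, m, 0, 0, [], 0, 0⟩

/-- When all packets wait for the last link, this becomes the first link. -/
def renew (k : Config) : Config :=
  if k.short = 0 ∧ k.inner = 0 ∧ k.outer = 0 ∧ k.mid = [] ∧ k.side = 0 then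
    clean (k.base + 2) k.last
  else k

/-- The links from which a packet may move to `f`. -/
def pred (f : Link 4 2) : List (Link 4 2) := [(f.1 - 1, 0), (f.1 - 1, 1)]

theorem link_cases (o : ZMod 4) (f : Link 4 2) :
    f = (o, 0) ∨ f = (o, 1) ∨ f = (o + 1, 0) ∨ f = (o + 1, 1) ∨ f = (o + 2, 0) ∨ f = (o + 2, 1) ∨
      f = (o + 3, 0) ∨ f = (o + 3, 1) := by
  revert o f
  decide

theorem base_ne (o : ZMod 4) : o ≠ o + 1 ∧ o ≠ o + 2 ∧ o ≠ o + 3 ∧ o + 1 ≠ o ∧ o + 1 ≠ o + 2 ∧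
    o + 1 ≠ o + 3 ∧ o + 2 ≠ o ∧ o + 2 ≠ o + 1 ∧ o + 2 ≠ o + 3 ∧ o + 3 ≠ o ∧ o + 3 ≠ o + 1 ∧
      o + 3 ≠ o + 2 ∧ o - 1 = o + 3 ∧ o + 1 - 1 = o ∧ o + 2 - 1 = o + 1 ∧ o + 3 - 1 = o + 2 := by
  revert o
  decide

/-- A configuration lists the inner packets before the outer ones, so appending an inner packet at
the end requires that no outer one waits. -/
theorem queue_inject (k : Config) (hk : 0 < k.short → k.outer = 0) (f : Link 4 2) :
    k.inject.queue f = k.queue f ++ k.injection.filter fun ρ => ρ.head? = some f := by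
  obtain ⟨o, s, x, y, B, c, d⟩ := k
  obtain ⟨h1, h2, h3, h4, h5, h6, h7, h8, h9, h10, h11, h12, -⟩ := base_ne o
  simp only at hk
  by_cases hs : 0 < s
  · obtain rfl := hk hs
    rcases link_cases o f with rfl | rfl | rfl | rfl | rfl | rfl | rfl | rfl <;>
      simp [inject, injection, queue, innerRoute, outerRoute, *, List.replicate_succ']
  by_cases hx : 0 < x
  · rcases link_cases o f with rfl | rfl | rfl | rfl | rfl | rfl | rfl | rfl <;>
      simp [inject, injection, queue, innerRoute, outerRoute, *, List.replicate_succ']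
  by_cases hy : 0 < y
  · rcases link_cases o f with rfl | rfl | rfl | rfl | rfl | rfl | rfl | rfl <;>
      simp [inject, injection, queue, innerRoute, outerRoute, *,
        List.replicate_succ']
  · simp [inject, injection, hs, hx, hy]

/-- Packets at the last link have one hop left, so they are the short packets of a configuration
based there. -/
theorem queue_renew (k : Config) (f : Link 4 2) : k.renew.queue f = k.queue f := by
  rw [renew]
  split_ifs with h
  · obtain ⟨o, s, x, y, B, c, d⟩ := k
    obtain ⟨rfl, rfl, rfl, rfl, rfl⟩ := h
    obtain ⟨h1, h2, h3, h4, h5, h6, h7, h8, h9, h10, h11, h12, -⟩ := base_ne o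
    have h13 : o ≠ o + 2 + 1 := by revert o; decide
    rcases link_cases o f with rfl | rfl | rfl | rfl | rfl | rfl | rfl | rfl <;>
      simp [clean, queue, *]
  · rfl

theorem cons_replicate {α : Type*} (m : ℕ) (x : α) :
    x :: List.replicate m x = List.replicate m x ++ [x] := by
  rw [← List.replicate_succ, List.replicate_succ']

theorem cons_replicate_append {α : Type*} (m : ℕ) (x : α) (l : List α) :
    x :: (List.replicate m x ++ l) = List.replicate m x ++ x :: l := by
  rw [← List.cons_append, cons_replicate, List.append_assoc, List.singleton_append]

theorem queue_forward (k : Config) (f : Link 4 2) :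
    k.forward.queue f = (k.queue f).tail ++
      (pred f).flatMap fun e => forwardedRoutes (k.queue e) f := by
  obtain ⟨o, s, x, y, B, c, d⟩ := k
  obtain ⟨h1, h2, h3, h4, h5, h6, h7, h8, h9, h10, h11, h12, h13, h14, h15, h16⟩ := base_ne o
  rcases link_cases o f with rfl | rfl | rfl | rfl | rfl | rfl | rfl | rfl <;>
    simp only [pred, h13, h14, h15, h16, List.flatMap_cons, List.flatMap_nil, List.append_nil]
  · rcases s with _ | s <;> rcases x with _ | x <;> rcases y with _ | y <;>
      simp [forward, queue, forwardedRoutes, *, List.replicate_succ, innerRoute, outerRoute]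
  · simp [forward, queue, forwardedRoutes, *]
  · rcases s with _ | s <;> rcases x with _ | x <;> rcases y with _ | y <;>
      simp [forward, queue, forwardedRoutes, *, List.replicate_succ, innerRoute, outerRoute]
  · rcases s with _ | s <;> rcases x with _ | x <;> rcases y with _ | y <;>
      simp [forward, queue, forwardedRoutes, *, List.replicate_succ, innerRoute, outerRoute]
    simp [cons_replicate]
  · rcases B with _ | ⟨_ | _, B⟩ <;> rcases c with _ | c <;>
      simp [forward, queue, forwardedRoutes, *, List.replicate_succ, innerRoute, outerRoute] <;>
      simp [cons_replicate, cons_replicate_append]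
  · rcases B with _ | ⟨_ | _, B⟩ <;> rcases c with _ | c <;>
      simp [forward, queue, forwardedRoutes, *, List.replicate_succ, innerRoute, outerRoute]
  · rcases d with _ | d <;>
      simp [forward, queue, forwardedRoutes, *, List.replicate_succ]
  · rcases d with _ | d <;>
      simp [forward, queue, forwardedRoutes, *, List.replicate_succ]


/-! #### The run of the adversary -/

/-- The adversary pauses every tenth step. -/
def adapt (t : ℕ) (k : Config) : Config := if t % 10 = 0 then k else k.inject

/-- The state at the beginning of step `t`, when `m` packets are injected at the start. -/
def run (m : ℕ) : ℕ → Config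
  | 0 => clean 0 m
  | t + 1 => (adapt t (run m t)).forward.renew

/-- The routes of the injected packets. -/
def traffic (m : ℕ) : Traffic (Link 4 2) := fun t =>
  if t = 0 then List.replicate m [(0, 0)]
  else if t % 10 = 0 then [] else (run m t).injection

theorem outer_eq_zero_of_short_pos (m t : ℕ) : 0 < (run m t).short → (run m t).outer = 0 := by
  induction t with
  | zero => simp [run, clean]
  | succ t ih =>
    rw [run]
    generalize run m t = k at ih
    obtain ⟨o, s, x, y, B, c, d⟩ := k
    simp only at ih
    intro h
    rw [renew] at h ⊢
    split_ifs at h ⊢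
    · rfl
    · rcases Nat.eq_zero_or_pos s with rfl | hs
      · exfalso
        simp only [adapt, inject, forward] at h
        split_ifs at h <;> simp_all
      · have := ih hs
        simp only [adapt, inject, forward]
        split_ifs <;> simp_all

theorem queue_adapt (m t : ℕ) (f : Link 4 2) :
    (adapt (t + 1) (run m (t + 1))).queue f =
      (run m (t + 1)).queue f ++ (traffic m (t + 1)).filter fun ρ => ρ.head? = some f := by
  rw [adapt, traffic, if_neg (Nat.succ_ne_zero t)]
  split_ifs
  · simp
  · exact queue_inject _ (outer_eq_zero_of_short_pos m (t + 1)) f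

/-- The states describe the queues. -/
theorem map_snd_fifoQueue (m t : ℕ) (f : Link 4 2) :
    (fifoQueue pred (traffic m) t f).map Prod.snd = (adapt t (run m t)).queue f := by
  induction t generalizing f with
  | zero =>
    rw [map_snd_fifoQueue_zero]
    by_cases hf : f = (0, 0)
    · simp [traffic, adapt, run, clean, queue, hf]
    · simp [traffic, adapt, run, clean, queue, hf, Ne.symm hf]
  | succ t ih =>
    rw [map_snd_fifoQueue_succ, queue_adapt, run, queue_renew, queue_forward]
    simp only [ih]

/-! ### The injected routes are simple paths through consecutive links -/

theorem exists_base_of_mem_traffic {m t : ℕ} {path : List (Link 4 2)} (h : path ∈ traffic m t) :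
    ∃ o : ZMod 4, path ∈ [[(o, 0)], innerRoute o, outerRoute o] := by
  simp only [traffic, injection] at h
  split_ifs at h
  · exact ⟨0, by simp [List.eq_of_mem_replicate h]⟩
  · simp at h
  · exact ⟨(run m t).base, by simp_all⟩
  · rw [List.mem_cons, List.mem_singleton] at h
    rcases h with rfl | rfl
    · exact ⟨(run m t).base, by simp⟩
    · exact ⟨(run m t).base + 1, by simp⟩
  · exact ⟨(run m t).base + 2, by simp_all⟩
  · simp at h

/-- Source and destination of a path. -/
def packetOf (path : List (Link 4 2)) : Packet 4 where
  src := (path.map Prod.fst).headD 0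
  dst := (path.map Prod.fst).headD 0 + (path.length : ZMod 4)

theorem isPathOf_packetOf {m t : ℕ} {path : List (Link 4 2)} (h : path ∈ traffic m t) :
    IsPathOf (packetOf path) path := by
  obtain ⟨o, ho⟩ := exists_base_of_mem_traffic h
  clear h
  simp only [List.mem_cons, List.not_mem_nil, or_false] at ho
  rcases ho with rfl | rfl | rfl <;>
    simp only [IsPathOf, IsWalk, packetOf, innerRoute, outerRoute] <;> revert o <;> decide

theorem isRouting (m : ℕ) : IsRouting (fun t => (traffic m t).map packetOf) (traffic m) := by
  intro t
  rw [List.forall₂_map_left_iff, List.forall₂_same]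
  exact fun path h => isPathOf_packetOf h

theorem isPredecessorList (m : ℕ) : IsPredecessorList pred (traffic m) where
  nodup f := by simp [pred]
  mem i k e f he hf := by
    have hwalk : ∃ p : Packet 4, IsPathOf p (routeOf (traffic m) i) := by
      rcases hi : (traffic m i.1)[i.2]? with _ | path
      · simp [routeOf, hi] at he
      · exact ⟨_, by simpa [routeOf, hi] using isPathOf_packetOf (List.mem_of_getElem? hi)⟩
    obtain ⟨p, hp⟩ := hwalk
    have h1 := (isWalk_iff.1 hp.1).1
    have he' := congrArg (fun l : List (ZMod 4) => l[k]?) h1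
    have hf' := congrArg (fun l : List (ZMod 4) => l[k + 1]?) h1
    have hk : k < (routeOf (traffic m) i).length := (List.getElem?_eq_some_iff.1 he).1
    have hk' : k + 1 < (routeOf (traffic m) i).length := (List.getElem?_eq_some_iff.1 hf).1
    simp only [List.getElem?_map, he, hf, List.getElem?_range hk, List.getElem?_range hk',
      Option.map_some, Option.some.injEq] at he' hf'
    have h2 : e.1 = f.1 - 1 := by
      rw [he', hf']
      push_cast
      ring
    obtain ⟨a, j⟩ := e
    simp only at h2
    subst h2
    fin_cases j <;> simp [pred]

/-! ### Admissibility of the adversary's paths -/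

/-- The number of steps among the `k` steps from `t` on in which the adversary does not pause. -/
def slots (t k : ℕ) : ℕ := k + (t + 9) / 10 - (t + k + 9) / 10

theorem slots_succ (t k : ℕ) : slots t (k + 1) = slots t k + if (t + k) % 10 = 0 then 0 else 1 := by
  simp only [slots]
  split_ifs <;> omega

/-- The only simultaneous injections are an outer route and a single link of the other ring's middle
hop, which are disjoint. -/
theorem countP_injection_le (k : Config) (e : Link 4 2) :
    (k.injection.countP fun path => e ∈ path) ≤ 1 := by
  obtain ⟨h1, h2, h3, h4, h5, h6, h7, h8, h9, -⟩ := base_ne k.base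
  rw [injection]
  split_ifs
  · exact List.countP_le_length
  · by_cases he : e = (k.base + 1, 0)
    · simp [outerRoute, *]
    · simp only [List.countP_cons, List.mem_singleton, he]
      split_ifs <;> simp_all
  · exact List.countP_le_length
  · simp

theorem load_traffic_le (m t₀ T : ℕ) (e : Link 4 2) : load (traffic m) t₀ T e ≤ m + slots t₀ T := by
  have h1 : ∀ t, ((traffic m t).countP fun path => e ∈ path) ≤
      (if t = 0 then m else 0) + if t % 10 = 0 then 0 else 1 := by
    intro t
    rw [traffic]
    split_ifs with h0 h10
    · exact List.countP_le_length.trans (by simp)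
    · omega
    · simp
    · simpa using countP_injection_le _ e
  rw [load]
  refine (Finset.sum_le_sum fun t _ => le_trans (le_of_eq
    (List.countP_congr fun _ _ => by simp)) (h1 t)).trans ?_
  rw [Finset.sum_add_distrib]
  refine Nat.add_le_add ?_ (le_of_eq ?_)
  · rw [Finset.sum_ite_eq']
    split_ifs <;> omega
  · induction T with
    | zero => simp [slots]
    | succ T ih => rw [← add_assoc, Finset.sum_Ico_succ_top (by omega), ih, slots_succ]

/-- The load is at most m + (9T + 9)/10, and this is at most 19T/20 once T ≥ 20m + 18. -/
theorem admissible (m : ℕ) : Admissible (20 * m + 18) (19 / 20) (traffic m) := by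
  intro T hT t₀ e
  have h1 := load_traffic_le m t₀ T e
  have h2 : 20 * load (traffic m) t₀ T e ≤ 19 * T := by
    rw [slots] at h1
    omega
  have h3 : (20 : ℝ) * load (traffic m) t₀ T e ≤ 19 * T := by exact_mod_cast h2
  linarith

/-! #### One period -/

variable {m t : ℕ} {o : ZMod 4}

theorem run_first_phase {s k : ℕ} (h : run m t = clean o s) (hk : k ≤ s) (hs : 20 ≤ s) :
    run m (t + k) = ⟨o, s - k, slots t k, 0, [], 0, 0⟩ := by
  induction k with
  | zero => simp [h, clean, slots]
  | succ k ih =>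
    have h1 : 0 < s - k := by omega
    have h2 : s - k ≠ 0 := by omega
    -- When the last short packet leaves, some inner packet must be present, or `renew` could fire
    -- too early; s ≥ 20 guarantees one.
    have h3 : s - (k + 1) = 0 → slots t (k + 1) ≠ 0 := by
      simp only [slots]
      omega
    rw [← add_assoc, run, ih (by omega)]
    rw [slots_succ] at h3 ⊢
    by_cases h10 : (t + k) % 10 = 0
    · simp only [adapt, h10, if_true, forward, h2, false_and, if_false, List.tail_nil,
        List.append_nil, add_zero, List.head?_nil, lt_irrefl, Nat.zero_sub, Nat.sub_sub] at h3 ⊢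
      rw [renew, if_neg (by tauto)]
      simp
    · simp only [adapt, h10, if_false, inject, h1, if_true, forward, h2, false_and, List.tail_nil,
        List.append_nil, add_zero, List.head?_nil, lt_irrefl, Nat.zero_sub, Nat.sub_sub] at h3 ⊢
      rw [renew, if_neg (by tauto)]
      simp

theorem prefix_concat_cases {α : Type*} {P l : List α} {x : α} (h : P <+: l ++ [x]) :
    P = l ++ [x] ∨ P <+: l :=
  List.prefix_concat_iff.1 h

/-- D collects what the middle link has already served, so D ++ B is its arrival history. A step
appends false, true, or true alone in a pause; hence in every prefix the trues exceed the falses by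
at most the number k - slots t k of pauses. Applied to D, this shows that many trues are still
delayed in B. -/
theorem run_second_phase {x k : ℕ} (h : run m t = ⟨o, 0, x, 0, [], 0, 0⟩) (hk : k ≤ x) :
    ∃ (B D : List Bool) (d : ℕ), run m (t + k) = ⟨o, 0, x - k, slots t k, B, 0, d⟩ ∧
      D.length ≤ k ∧ B.length ≤ slots t k + 1 ∧ (D ++ B).count true = k ∧
      (D ++ B).count false = slots t k ∧
      ∀ P, P <+: D ++ B → P.count true + slots t k ≤ P.count false + k := by
  induction k with
  | zero =>
    refine ⟨[], [], 0, by simp [h, slots], by simp, by simp, by simp, by simp [slots], ?_⟩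
    intro P hP
    simp_all [slots]
  | succ k ih =>
    obtain ⟨B, D, d, hrun, hD, hB, ht, hf, hP⟩ := ih (by omega)
    have h1 : 0 < x - k := by omega
    have h2 : x - k ≠ 0 := by omega
    rw [← add_assoc, run, hrun, slots_succ]
    by_cases h10 : (t + k) % 10 = 0
    · have happ : D ++ B.take 1 ++ (B.tail ++ [true]) = D ++ B ++ [true] := by
        cases B <;> simp
      refine ⟨B.tail ++ [true], D ++ B.take 1,
        (adapt (t + k) ⟨o, 0, x - k, slots t k, B, 0, d⟩).forward.last, ?_, ?_, ?_, ?_, ?_, ?_⟩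
      · simp only [adapt, h10, if_true, forward, h1, h2, and_self, true_and, false_and, if_false,
          add_zero, lt_irrefl]
        rw [renew, if_neg (by simp), Nat.sub_sub]
      · simp only [List.length_append, List.length_take]
        omega
      · simp only [List.length_append, List.length_tail, List.length_singleton]
        omega
      · rw [happ, List.count_append, ht]
        simp
      · rw [happ, List.count_append, hf]
        simp [h10]
      · intro P hPre
        rw [happ] at hPre
        rw [if_pos h10]
        rcases prefix_concat_cases hPre with rfl | hPre
        · simp [List.count_append] at ht hf ⊢
          omega
        · have := hP P hPre
          omega
    · have happ : D ++ (B ++ [false]).take 1 ++ ((B ++ [false]).tail ++ [true]) =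
          D ++ B ++ [false] ++ [true] := by
        cases B <;> simp
      refine ⟨(B ++ [false]).tail ++ [true], D ++ (B ++ [false]).take 1,
        (adapt (t + k) ⟨o, 0, x - k, slots t k, B, 0, d⟩).forward.last, ?_, ?_, ?_, ?_, ?_, ?_⟩
      · simp only [adapt, h10, if_false, inject, lt_irrefl, forward, h1, h2, and_self, true_and,
          false_and, if_true, add_zero]
        rw [renew, if_neg (by simp), Nat.sub_sub]
      · simp only [List.length_append, List.length_take, List.length_singleton]
        omega
      · simp only [List.length_append, List.length_tail, List.length_singleton, if_neg h10]
        omega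
      · rw [happ, List.count_append, List.count_append, ht]
        simp
      · rw [happ, List.count_append, List.count_append, hf]
        simp [h10]
      · intro P hPre
        rw [happ] at hPre
        rw [if_neg h10]
        rcases prefix_concat_cases hPre with rfl | hPre
        · simp [List.count_append] at ht hf ⊢
          omega
        rcases prefix_concat_cases hPre with rfl | hPre
        · simp [List.count_append] at ht hf ⊢
          omega
        · have := hP P hPre
          omega

theorem count_true_drop (B : List Bool) (k : ℕ) :
    (B.drop k).count true =
      (B.drop (k + 1)).count true + if (B.drop k).head? = some true then 1 else 0 := by
  rw [← List.tail_drop]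
  rcases B.drop k with _ | ⟨_ | _, l⟩ <;> simp

/-- The packets at or bound for the last link, d' + (trues left) + c, gain one outer packet per
step, lose at most one to service, and gain one injection per non-pausing step. -/
theorem run_third_phase {y k d : ℕ} {B : List Bool} (h : run m t = ⟨o, 0, 0, y, B, 0, d⟩)
    (hk : k ≤ y) :
    ∃ c d', run m (t + k) = ⟨o, 0, 0, y - k, B.drop k, c, d'⟩ ∧ c = min k 1 ∧
      B.count true + slots t k ≤ d' + (B.drop k).count true + c := by
  induction k with
  | zero => exact ⟨0, d, by simp [h], by simp, by simp [slots]⟩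
  | succ k ih =>
    obtain ⟨c, d', hrun, hc, hΨ⟩ := ih (by omega)
    have h1 : 0 < y - k := by omega
    have h2 := count_true_drop B k
    rw [← add_assoc, run, hrun, slots_succ]
    have h3 : c - 1 + 1 = 1 := by omega
    by_cases h10 : (t + k) % 10 = 0
    · refine ⟨1, (adapt (t + k) ⟨o, 0, 0, y - k, B.drop k, c, d'⟩).forward.last, ?_, by omega, ?_⟩
      · simp only [adapt, h10, if_true, forward, lt_irrefl, h1, and_self, Nat.zero_sub, and_false,
          if_false, List.append_nil, List.tail_drop, h3]
        rw [renew, if_neg (by simp), Nat.sub_sub]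
      · simp only [adapt, h10, if_true, forward]
        split_ifs at * <;> omega
    · refine ⟨1, (adapt (t + k) ⟨o, 0, 0, y - k, B.drop k, c, d'⟩).forward.last, ?_, by omega, ?_⟩
      · simp only [adapt, h10, if_true, inject, forward, lt_irrefl, h1, and_self, Nat.zero_sub,
          and_false, if_false, List.append_nil, List.tail_drop, h3]
        rw [renew, if_neg (by simp), Nat.sub_sub]
      · simp only [adapt, h10, if_false, inject, lt_irrefl, h1, if_true, forward]
        split_ifs at * <;> omega

/-- Up to rounding, x = 0.9s and y = 0.9x. At least y/2 trues remain after the second phase, and the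
third adds 0.9y injections: about 1.4 · 0.81 s > 1.13 s in all. The bound s ≥ 100 absorbs the
rounding. -/
theorem run_period {s : ℕ} (h : run m t = clean o s) (hs : 100 ≤ s) :
    ∃ t' o' s', run m t' = clean o' s' ∧ s + 1 ≤ s' := by
  have h1 := run_first_phase h le_rfl (by omega)
  rw [Nat.sub_self] at h1
  obtain ⟨B, D, d, h2, hD, hB, ht, hf, hP⟩ := run_second_phase h1 le_rfl
  rw [Nat.sub_self] at h2
  obtain ⟨c, d', h3, hc, hΨ⟩ := run_third_phase h2 le_rfl
  set x := slots t s with hx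
  set y := slots (t + s) x with hy
  have hz : slots (t + s + x) y = y + (t + s + x + 9) / 10 - (t + s + x + y + 9) / 10 := rfl
  rw [slots] at hx hy
  have hpre := hP D (List.prefix_append D B)
  have hlen := List.count_true_add_count_false D
  rw [List.count_append] at ht
  obtain rfl : c = 1 := by omega
  have h4 : B.drop (y + 1) = [] := List.drop_eq_nil_of_le hB
  have h5 := count_true_drop B y
  rw [h4] at h5
  rw [List.count_nil, zero_add] at h5
  -- The extra step moves the last packet of the parallel link, and the at most one packet left in
  -- the middle queue, out of the way; then `renew` fires.
  refine ⟨t + s + x + y + 1, o + 2, (forward ⟨o, 0, 0, 0, B.drop y, 1, d'⟩).last, ?_, ?_⟩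
  · rw [run, h3]
    have h6 : ∀ t' d', adapt t' ⟨o, 0, 0, y - y, B.drop y, 1, d'⟩ =
        ⟨o, 0, 0, 0, B.drop y, 1, d'⟩ := by
      intro t' d'
      simp [adapt, inject]
    rw [h6, renew, if_pos (by simp [forward, List.tail_drop, h4])]
    rfl
  · simp only [forward, zero_lt_one, if_true]
    omega

/-! ### Unbounded growth over the periods -/

theorem run_unbounded (l : ℕ) : ∃ t o s, run 100 t = clean o s ∧ 100 + l ≤ s := by
  induction l with
  | zero => exact ⟨0, 0, 100, rfl, le_rfl⟩
  | succ l ih =>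
    obtain ⟨t, o, s, h, hs⟩ := ih
    obtain ⟨t', o', s', h', hs'⟩ := run_period h (by omega)
    exact ⟨t', o', s', h', by omega⟩

theorem inNetwork_unbounded :
    ¬ ∃ B : ℕ, ∀ s, (inNetwork (traffic 100) (fifoSchedule pred (traffic 100)) s).encard ≤ B := by
  rintro ⟨N, hN⟩
  obtain ⟨t, o, s, h, hs⟩ := run_unbounded N
  have h1 := ((isPredecessorList 100).length_le_encard t (o, 0)).trans (hN t)
  have h2 : (fifoQueue pred (traffic 100) t (o, 0)).length ≤ N := by exact_mod_cast h1
  have h3 := congrArg List.length (map_snd_fifoQueue 100 t (o, 0))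
  have h4 : s ≤ ((adapt t (run 100 t)).queue (o, 0)).length := by
    rw [h]
    simp only [adapt, inject, clean, queue]
    split_ifs <;> simp_all
  rw [List.length_map] at h3
  omega

end Config

end RingRouting

end

/-! ### Assembly of both parts -/

theorem mainTheorem4 :
    (∀ (n c w : ℕ) [NeZero n] (r : ℝ), 1 ≤ c → 0 < r → r < 1 →
      -- every window size `w` is reached by a suitable `β`
      (∃ β : ℝ, 0 < β ∧ β < 1 ∧ w ≤ windowLength n c r β) ∧
      ∀ β : ℝ, 0 < β → β < 1 → w ≤ windowLength n c r β →
        -- the algorithm exists, i.e. a suitable single ring can always be chosen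
        (∃ A : OnlineRouter n c, FollowsEstimator r (windowLength n c r β) A) ∧
        ∃ B : ℕ, ∀ A : OnlineRouter n c, FollowsEstimator r (windowLength n c r β) A →
          ∀ inj : Injections n, AdmissibleInjections c w r inj →
            IsRouting inj (A.traffic inj) ∧
            WeaklyAdmissible (windowLength n c r β) (1 - (1 - r) ^ 2) (A.traffic inj) ∧
            ∀ S : Schedule (Link n c), IsGreedy (A.traffic inj) S →
              BoundedBy (A.traffic inj) S B) ∧
    -- the 4-ring with 2 parallel links is unstable under FIFO if the adversary picks the routes
    (∃ (w : ℕ) (r : ℝ) (inj : Injections 4) (π : Traffic (Link 4 2)) (S : Schedule (Link 4 2)),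
      0 < r ∧ r < 1 ∧ IsRouting inj π ∧ Admissible w r π ∧ IsFIFO π S ∧
        ¬ ∃ B : ℕ, ∀ s, (inNetwork π S s).encard ≤ B) := by
  refine ⟨fun n c w _ r hc hr hr1 => ⟨exists_le_windowLength w hc hr hr1,
    fun β hβ hβ1 hw => ⟨exists_followsEstimator r _ hc, ?_⟩⟩, ?_⟩
  · have hW := windowLength_pos (n := n) hc hr hr1 hβ hβ1
    -- The spare rate δ = ε² is 1 - R. B is fixed before the algorithm and the injections.
    obtain ⟨B, hB⟩ := exists_boundedBy n c hW (δ := (1 - r) ^ 2) (pow_pos (by linarith) 2)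
      (pow_le_one₀ (by linarith) (by linarith))
    refine ⟨B, fun A hA inj hinj => ?_⟩
    have hadm := hA.weaklyAdmissible hc hr hr1 hβ hβ1 hw hW hinj
    exact ⟨isRouting_traffic A inj, hadm, hB _ (followsRings_traffic A inj) hadm⟩
  · exact ⟨20 * 100 + 18, 19 / 20, _, Config.traffic 100, fifoSchedule Config.pred _, by norm_num,
      by norm_num, Config.isRouting 100, Config.admissible 100,
      (Config.isPredecessorList 100).isFIFO, Config.inNetwork_unbounded⟩
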